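/- Let $S^3\subset\mathbb{R}^4$ be the round sphere of radius $1/2$, and let $UT^*S^3=\{(q,p): q\in S^3,\ \langle q,p\rangle=0,\ |p|=1\}$ be its unit cotangent bundle (covectors are identified with vectors by the round metric), with the contact form $\alpha=p\,dq$. Let $\omega_{FS}$ be the Fubini--Study form on $\mathbb{C}P^1$ for which $\mathbb{C}P^1$ has area $\pi$; thus $(\mathbb{C}P^1,\omega_{FS})$ is the round sphere of radius $1/2$ in $\mathbb{R}^3$ with its area form. Let $\mathrm{pr}\colon UT^*S^3\to\mathbb{C}P^1\times\mathbb{C}P^1$ send $(q,p)$ to the self-dual and the anti-self-dual part of the bivector $q\wedge p$. With $m_{ij}=q_ip_j-q_jp_i$ for $0\le i,j\le 3$, this is $$\mathrm{pr}(q,p)=\bigl((m_{03}+m_{12},\,m_{02}-m_{13},\,m_{01}+m_{23}),\ (m_{03}-m_{12},\,-m_{02}-m_{13},\,m_{01}-m_{23})\bigr).$$ Equivalently, $\mathrm{pr}$ is the projection $z\otimes w\mapsto([z],[w])$ of the unit circle bundle of $\mathcal{O}(-1,-1)$, where $W=p+2iq$ is identified with the rank one matrix $$\tfrac12\begin{pmatrix}W_0+iW_1&W_2+iW_3\\-W_2+iW_3&W_0-iW_1\end{pmatrix}=zw^{T},\qquad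 |z|=|w|=1 .$$ Let $L\subset\mathbb{C}P^1\times\mathbb{C}P^1$ be the monotone product torus, that is, the product of the equators $\{x_3=0\}$. The canonical $k$-fold Bohr--Sommerfeld cover of a Lagrangian torus $L$ is defined as follows. The number $k\ge 1$ is the smallest for which every disc with boundary on $L$ has symplectic area in $\frac{\pi}{k}\mathbb{Z}$. The cover is the $k$-fold cover $\iota\colon\mathbb{T}^2\to L$ for which a loop in $L$ lifts to a closed loop if and only if it bounds symplectic area in $\pi\mathbb{Z}$. A Legendrian lift of $\iota$ is a smooth map $f\colon\mathbb{T}^2\to UT^*S^3$ with $f^*\alpha=0$ and $\mathrm{pr}\circ f=\iota$. The conormal lift of a knot $K\subset S^3$ is $\Lambda_K=\{(q,p)\in UT^*S^3: q\in K,\ p|_{T_qK}=0\}$. An unknot is a knot that is smoothly ambient isotopic to a great circle. Two Legendrian tori are Legendrian isotopic if they are the images of the two ends of a smooth family of Legendrian embeddings $F_t\colon\mathbb{T}^2\to UT^*S^3$, $t\in[0,1]$. **Theorem.** 1. The map $\mathrm{pr}$ makes $(UT^*S^3,p\,dq)$ a prequantisation bundle over $(\mathbb{C}P^1\times\mathbb{C}P^1,\omega_{FS}\oplus\omega_{FS})$: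 the Reeb flow is a free action of $\mathbb{R}/\pi\mathbb{Z}$ whose orbits are the fibres of $\mathrm{pr}$, and $\mathrm{pr}^*(\omega_{FS}\oplus\omega_{FS})=d\alpha$. 2. The product torus $L$ has a canonical twofold Bohr--Sommerfeld cover by a torus, and this cover has a Legendrian lift. 3. Every Legendrian lift $f$ of the canonical twofold Bohr--Sommerfeld cover of $L$ is an embedding. For every unknot $K\subset S^3$, the Legendrian torus $f(\mathbb{T}^2)$ is Legendrian isotopic to the conormal lift $\Lambda_K$. -/

import Mathlib

open Set
open scoped ContDiff RealInnerProductSpace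

namespace UnknotLift

/-! ### The symplectic manifold `(ℂP¹ × ℂP¹, ω_FS ⊕ ω_FS)`

A line in `ℂP¹` has symplectic area `π`.  With this normalisation `(ℂP¹, ω_FS)` is the round sphere of
radius `1/2` in `ℝ³` with its area form.  The lemmas `hopf_image`, `hopf_eq_iff` and `hopf_pullback` below
identify it with the symplectic reduction of `S³ ⊂ ℂ²` with the contact form `½ ∑ (x dy - y dx)`. -/

abbrev V3 := EuclideanSpace ℝ (Fin 3)
abbrev V4 := EuclideanSpace ℝ (Fin 4)

/-- `ℂP¹` as the sphere of radius `1/2` in `ℝ³`. -/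
def CP1 : Set V3 := {x | ‖x‖ = 1 / 2}

/-- The Fubini–Study form at `x`: the area form `2 det (x, u, v)` of the sphere of radius `1/2`. -/
def omegaFS (x u v : V3) : ℝ :=
  2 * (x 0 * (u 1 * v 2 - u 2 * v 1) + x 1 * (u 2 * v 0 - u 0 * v 2) + x 2 * (u 0 * v 1 - u 1 * v 0))

/-- `ℂP¹ × ℂP¹`. -/
def M : Set (V3 × V3) := {m | m.1 ∈ CP1 ∧ m.2 ∈ CP1}

/-- `ω_FS ⊕ ω_FS` at the point `m`. -/
def omega (m u v : V3 × V3) : ℝ := omegaFS m.1 u.1 v.1 + omegaFS m.2 u.2 v.2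

/-- The monotone product torus: the product of the equators. -/
def productTorus : Set (V3 × V3) := {m | m ∈ M ∧ m.1 2 = 0 ∧ m.2 2 = 0}

/-- The Hopf map `(z₀, z₁) ↦ (conj z₀ * z₁, (|z₀|² - |z₁|²) / 2) ∈ ℂ × ℝ = ℝ³`, where
`z₀ = z 0 + i z 1` and `z₁ = z 2 + i z 3`. On the unit sphere it is the quotient map onto `ℂP¹`. -/
noncomputable def hopf (z : V4) : V3 :=
  !₂[z 0 * z 2 + z 1 * z 3, z 0 * z 3 - z 1 * z 2, (z 0 ^ 2 + z 1 ^ 2 - z 2 ^ 2 - z 3 ^ 2) / 2]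

/-- Scalar multiplication of `z ∈ ℂ² = ℝ⁴` by the complex number `a + i b`. -/
def cmul (a b : ℝ) (z : V4) : V4 :=
  !₂[a * z 0 - b * z 1, a * z 1 + b * z 0, a * z 2 - b * z 3, a * z 3 + b * z 2]

theorem norm_V4_sq (z : V4) : ‖z‖ ^ 2 = z 0 ^ 2 + z 1 ^ 2 + z 2 ^ 2 + z 3 ^ 2 := by
  simp [EuclideanSpace.norm_sq_eq, Fin.sum_univ_four]

theorem norm_V3_sq (z : V3) : ‖z‖ ^ 2 = z 0 ^ 2 + z 1 ^ 2 + z 2 ^ 2 := by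
  simp [EuclideanSpace.norm_sq_eq, Fin.sum_univ_three]

theorem norm_V4_one {z : V4} : ‖z‖ = 1 ↔ z 0 ^ 2 + z 1 ^ 2 + z 2 ^ 2 + z 3 ^ 2 = 1 := by
  rw [← norm_V4_sq]
  exact (pow_eq_one_iff_of_nonneg (norm_nonneg z) two_ne_zero).symm

theorem mem_CP1 {x : V3} : x ∈ CP1 ↔ x 0 ^ 2 + x 1 ^ 2 + x 2 ^ 2 = 1 / 4 := by
  rw [← norm_V3_sq, CP1, mem_ofPred_eq]
  constructor
  · intro h; rw [h]; norm_num
  · intro h; nlinarith [norm_nonneg x]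

/-- The Hopf map sends the unit sphere of `ℂ²` onto `ℂP¹`. -/
theorem hopf_image : hopf '' {z | ‖z‖ = 1} = CP1 := by
  ext x
  simp only [mem_image, mem_ofPred_eq, norm_V4_one, mem_CP1]
  constructor
  · rintro ⟨z, hz, rfl⟩
    simp only [hopf, Matrix.cons_val]
    linear_combination (1 / 4) * (z 0 ^ 2 + z 1 ^ 2 + z 2 ^ 2 + z 3 ^ 2 + 1) * hz
  · intro hx
    by_cases h : x 2 = -(1 / 2)
    · have h0 : x 0 = 0 := by nlinarith [sq_nonneg (x 0), sq_nonneg (x 1)]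
      have h1 : x 1 = 0 := by nlinarith [sq_nonneg (x 0), sq_nonneg (x 1)]
      refine ⟨!₂[0, 0, 1, 0], by simp, ?_⟩
      ext i
      fin_cases i <;> simp [hopf, h, h0, h1]
      norm_num
    · have hp : 0 < 1 / 2 + x 2 := by
        have h3 : x 2 ^ 2 ≤ 1 / 4 := by nlinarith [sq_nonneg (x 0), sq_nonneg (x 1)]
        rcases lt_trichotomy (x 2) (-(1 / 2)) with h' | h' | h'
        · nlinarith
        · exact absurd h' h
        · linarith
      set r := √(1 / 2 + x 2) with hr
      have hr0 : 0 < r := Real.sqrt_pos.2 hp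
      have hr2 : r ^ 2 = 1 / 2 + x 2 := Real.sq_sqrt hp.le
      have key : (x 0 / r) ^ 2 + (x 1 / r) ^ 2 = 1 / 2 - x 2 := by
        have : x 0 ^ 2 + x 1 ^ 2 = (1 / 2 - x 2) * r ^ 2 := by rw [hr2]; linarith
        field_simp
        linarith
      refine ⟨!₂[r, 0, x 0 / r, x 1 / r], ?_, ?_⟩
      · simp only [Matrix.cons_val]
        linarith
      · ext i
        fin_cases i <;> simp only [hopf, Matrix.cons_val, Fin.zero_eta, Fin.mk_one,
          Fin.reduceFinMk]
        · field_simp; ring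
        · field_simp; ring
        · linarith

/-- The fibres of the Hopf map on the unit sphere are the orbits of the unit complex numbers. -/
theorem hopf_eq_iff {z w : V4} (hz : ‖z‖ = 1) (hw : ‖w‖ = 1) :
    hopf z = hopf w ↔ ∃ a b : ℝ, a ^ 2 + b ^ 2 = 1 ∧ w = cmul a b z := by
  rw [norm_V4_one] at hz hw
  constructor
  · intro h
    have h0 : hopf z 0 = hopf w 0 := by rw [h]
    have h1 : hopf z 1 = hopf w 1 := by rw [h]
    have h2 : hopf z 2 = hopf w 2 := by rw [h]
    simp only [hopf, Matrix.cons_val] at h0 h1 h2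
    have e0 : z 0 ^ 2 + z 1 ^ 2 = w 0 ^ 2 + w 1 ^ 2 := by linarith
    have e1 : z 2 ^ 2 + z 3 ^ 2 = w 2 ^ 2 + w 3 ^ 2 := by linarith
    obtain ⟨a, ha⟩ : ∃ a, a = z 0 * w 0 + z 1 * w 1 + z 2 * w 2 + z 3 * w 3 := ⟨_, rfl⟩
    obtain ⟨b, hb⟩ : ∃ b, b = z 0 * w 1 - z 1 * w 0 + z 2 * w 3 - z 3 * w 2 := ⟨_, rfl⟩
    have c0 : w 0 = a * z 0 - b * z 1 := by
      rw [ha, hb]; linear_combination (-w 0) * hz + w 0 * e1 - w 2 * h0 - w 3 * h1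
    have c1 : w 1 = a * z 1 + b * z 0 := by
      rw [ha, hb]; linear_combination (-w 1) * hz + w 1 * e1 - w 3 * h0 + w 2 * h1
    have c2 : w 2 = a * z 2 - b * z 3 := by
      rw [ha, hb]; linear_combination (-w 2) * hz + w 2 * e0 - w 0 * h0 + w 1 * h1
    have c3 : w 3 = a * z 3 + b * z 2 := by
      rw [ha, hb]; linear_combination (-w 3) * hz + w 3 * e0 - w 1 * h0 - w 0 * h1
    refine ⟨a, b, ?_, ?_⟩
    · rw [c0, c1, c2, c3] at hw
      linear_combination hw - (a ^ 2 + b ^ 2) * hz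
    · ext i
      fin_cases i <;> simp only [cmul, Matrix.cons_val, Fin.zero_eta, Fin.mk_one,
          Fin.reduceFinMk] <;> assumption
  · rintro ⟨a, b, hab, rfl⟩
    ext i
    fin_cases i <;> simp only [hopf, cmul, Matrix.cons_val, Fin.zero_eta, Fin.mk_one,
          Fin.reduceFinMk]
    · linear_combination (-(z 0 * z 2 + z 1 * z 3)) * hab
    · linear_combination (-(z 0 * z 3 - z 1 * z 2)) * hab
    · linear_combination (-(z 0 ^ 2 + z 1 ^ 2 - z 2 ^ 2 - z 3 ^ 2) / 2) * hab

/-- On the unit sphere the Hopf map pulls `ω_FS` back to the differential `∑ dx ∧ dy` of the form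
`½ ∑ (x dy - y dx)`. -/
theorem hopf_pullback {z u v : V4} (hz : ‖z‖ = 1) (hu : ⟪z, u⟫ = 0) (hv : ⟪z, v⟫ = 0) :
    omegaFS (hopf z) (fderiv ℝ hopf z u) (fderiv ℝ hopf z v) =
      (u 0 * v 1 - u 1 * v 0) + (u 2 * v 3 - u 3 * v 2) := by
  have hd : Differentiable ℝ hopf := by
    rw [differentiable_euclidean]
    intro i
    fin_cases i <;> simp [hopf] <;> fun_prop
  have key : ∀ w : V4, fderiv ℝ hopf z w =
      !₂[w 0 * z 2 + z 0 * w 2 + w 1 * z 3 + z 1 * w 3,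
        w 0 * z 3 + z 0 * w 3 - w 1 * z 2 - z 1 * w 2,
        z 0 * w 0 + z 1 * w 1 - z 2 * w 2 - z 3 * w 3] := by
    intro w
    rw [← (hd z).lineDeriv_eq_fderiv]
    refine HasLineDerivAt.lineDeriv ?_
    set D : V3 := !₂[w 0 * z 2 + z 0 * w 2 + w 1 * z 3 + z 1 * w 3,
        w 0 * z 3 + z 0 * w 3 - w 1 * z 2 - z 1 * w 2,
        z 0 * w 0 + z 1 * w 1 - z 2 * w 2 - z 3 * w 3] with hD
    have h : (fun t : ℝ => hopf (z + t • w)) = fun t => hopf z + t • D + t ^ 2 • hopf w := by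
      funext t
      ext i
      fin_cases i <;> simp [hopf, hD] <;> ring
    have h1 : HasDerivAt (fun t : ℝ => t • D) ((1 : ℝ) • D) 0 := (hasDerivAt_id (0 : ℝ)).smul_const D
    have h2 : HasDerivAt (fun t : ℝ => t ^ 2 • hopf w) ((0 : ℝ) • hopf w) 0 := by
      simpa using (hasDerivAt_pow 2 (0 : ℝ)).smul_const (hopf w)
    have h3 := (h1.const_add (hopf z)).add h2
    rw [one_smul, zero_smul, add_zero] at h3
    rw [HasLineDerivAt, h]
    exact h3
  rw [norm_V4_one] at hz
  simp only [PiLp.inner_apply, Fin.sum_univ_four, RCLike.inner_apply, conj_trivial] at hu hv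
  rw [key, key]
  simp only [omegaFS, hopf, Matrix.cons_val]
  linear_combination ((z 0 ^ 2 + z 1 ^ 2 + z 2 ^ 2 + z 3 ^ 2) + 1) *
      ((u 0 * v 1 - u 1 * v 0) + (u 2 * v 3 - u 3 * v 2)) * hz
    - (z 0 ^ 2 + z 1 ^ 2 + z 2 ^ 2 + z 3 ^ 2) *
      ((z 0 * v 1 - z 1 * v 0) + (z 2 * v 3 - z 3 * v 2)) * hu
    - (z 0 ^ 2 + z 1 ^ 2 + z 2 ^ 2 + z 3 ^ 2) *
      ((u 0 * z 1 - u 1 * z 0) + (u 2 * z 3 - u 3 * z 2)) * hv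

/-! ### The unit cotangent bundle of the round three-sphere of radius `1/2`

Covectors on `S³ ⊂ ℝ⁴` are identified with tangent vectors by the round metric: `(q, p)` stands for the
covector `⟪p, ·⟫` on `T_q S³`, where `p` is orthogonal to `q`; its norm is `‖p‖`. -/

/-- The round three-sphere of radius `1/2`. -/
def S3 : Set V4 := {q | ‖q‖ = 1 / 2}

/-- The unit cotangent bundle `UT*S³`. -/
def UTS3 : Set (V4 × V4) := {e | e.1 ∈ S3 ∧ ⟪e.1, e.2⟫ = 0 ∧ ‖e.2‖ = 1}

/-- The tangent space of `UT*S³` at `e`. -/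
def tangentUTS3 (e : V4 × V4) : Set (V4 × V4) :=
  {v | ⟪e.1, v.1⟫ = 0 ∧ ⟪e.1, v.2⟫ + ⟪v.1, e.2⟫ = 0 ∧ ⟪e.2, v.2⟫ = 0}

/-- The contact form `p dq`. -/
noncomputable def alpha (e v : V4 × V4) : ℝ := ⟪e.2, v.1⟫

/-- Its differential `dp ∧ dq`. -/
noncomputable def dalpha (u v : V4 × V4) : ℝ := ⟪u.2, v.1⟫ - ⟪v.2, u.1⟫

/-- The flow of the vector field `(p, -4 q)`: the unit speed geodesic flow. -/
noncomputable def reebFlow (t : ℝ) (e : V4 × V4) : V4 × V4 :=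
  (Real.cos (2 * t) • e.1 + (Real.sin (2 * t) / 2) • e.2,
    -(2 * Real.sin (2 * t)) • e.1 + Real.cos (2 * t) • e.2)

/-- `pr : UT*S³ → ℂP¹ × ℂP¹` is a prequantisation bundle for `ω_FS ⊕ ω_FS` with connection form `p dq`:
the Reeb flow is a free action of `ℝ / π ℤ` whose orbits are the fibres of `pr`, and the curvature
of `p dq` is `ω_FS ⊕ ω_FS`. -/
structure IsPrequantisation (pr : V4 × V4 → V3 × V3) : Prop where
  smooth : ContDiff ℝ ∞ pr
  image : pr '' UTS3 = M
  flow_mem : ∀ t, ∀ e ∈ UTS3, reebFlow t e ∈ UTS3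
  flow_zero : ∀ e, reebFlow 0 e = e
  flow_deriv : ∀ e t, HasDerivAt (fun s => reebFlow s e)
    ((reebFlow t e).2, (-4 : ℝ) • (reebFlow t e).1) t
  reeb_alpha : ∀ e ∈ UTS3, alpha e (e.2, (-4 : ℝ) • e.1) = 1
  reeb_dalpha : ∀ e ∈ UTS3, ∀ v ∈ tangentUTS3 e, dalpha (e.2, (-4 : ℝ) • e.1) v = 0
  free : ∀ e ∈ UTS3, ∀ t, reebFlow t e = e ↔ ∃ n : ℤ, t = n * Real.pi
  fibre : ∀ e ∈ UTS3, ∀ e' ∈ UTS3, pr e = pr e' ↔ ∃ t, e' = reebFlow t e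
  curvature : ∀ e ∈ UTS3, ∀ u ∈ tangentUTS3 e, ∀ v ∈ tangentUTS3 e,
    omega (pr e) (fderiv ℝ pr e u) (fderiv ℝ pr e v) = dalpha u v

/-- The Plücker coordinates of `q ∧ p`. -/
def pluecker (e : V4 × V4) (i j : Fin 4) : ℝ := e.1 i * e.2 j - e.1 j * e.2 i

/-- The prequantisation projection `UT*S³ → ℂP¹ × ℂP¹`: it sends `(q, p)` to the self-dual and the
anti-self-dual part of the bivector `q ∧ p`, that is, of the oriented geodesic through `q` in direction `p`.
See `proj_eq_hopf` for the same map through the Segre embedding. -/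
noncomputable def proj (e : V4 × V4) : V3 × V3 :=
  (!₂[pluecker e 0 3 + pluecker e 1 2, pluecker e 0 2 - pluecker e 1 3, pluecker e 0 1 + pluecker e 2 3],
   !₂[pluecker e 0 3 - pluecker e 1 2, -pluecker e 0 2 - pluecker e 1 3,
      pluecker e 0 1 - pluecker e 2 3])

/-- The vector of `ℂ²` with the real coordinates `z`. -/
def toC (z : V4) : Fin 2 → ℂ := ![⟨z 0, z 1⟩, ⟨z 2, z 3⟩]

/-- With `W = p + 2 i q` on the cone `∑ W_j² = 0` over the conic: a matrix of norm one whose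
determinant is `¼ ∑ W_j² = 0`. -/
noncomputable def segreMatrix (e : V4 × V4) : Matrix (Fin 2) (Fin 2) ℂ :=
  let W : Fin 4 → ℂ := fun j => ⟨e.2 j, 2 * e.1 j⟩
  !![(W 0 + Complex.I * W 1) / 2, (W 2 + Complex.I * W 3) / 2;
     (-W 2 + Complex.I * W 3) / 2, (W 0 - Complex.I * W 1) / 2]

/-- In terms of the unit circle bundle of `𝒪(-1,-1)`, which consists of the tensors `z ⊗ w` of unit vectors
of `ℂ²`, the map `proj` is `z ⊗ w ↦ ([z], [w])`. -/
theorem proj_eq_hopf {e : V4 × V4} {z w : V4} (hz : ‖z‖ = 1) (hw : ‖w‖ = 1)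
    (h : segreMatrix e = Matrix.vecMulVec (toC z) (toC w)) : proj e = (hopf z, hopf w) := by
  rw [norm_V4_one] at hz hw
  have h00 := congrFun (congrFun h 0) 0
  have h01 := congrFun (congrFun h 0) 1
  have h10 := congrFun (congrFun h 1) 0
  have h11 := congrFun (congrFun h 1) 1
  simp [segreMatrix, toC, Complex.ext_iff, Matrix.vecMulVec_apply] at h00 h01 h10 h11
  obtain ⟨r00, i00⟩ := h00
  obtain ⟨r01, i01⟩ := h01
  obtain ⟨r10, i10⟩ := h10
  obtain ⟨r11, i11⟩ := h11
  have p0 : e.2 0 = (z 0 * w 0 - z 1 * w 1) + (z 2 * w 2 - z 3 * w 3) := by linarith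
  have p1 : e.2 1 = (z 0 * w 1 + z 1 * w 0) - (z 2 * w 3 + z 3 * w 2) := by linarith
  have p2 : e.2 2 = (z 0 * w 2 - z 1 * w 3) - (z 2 * w 0 - z 3 * w 1) := by linarith
  have p3 : e.2 3 = (z 0 * w 3 + z 1 * w 2) + (z 2 * w 1 + z 3 * w 0) := by linarith
  have q0 : e.1 0 = ((z 0 * w 1 + z 1 * w 0) + (z 2 * w 3 + z 3 * w 2)) / 2 := by linarith
  have q1 : e.1 1 = ((z 2 * w 2 - z 3 * w 3) - (z 0 * w 0 - z 1 * w 1)) / 2 := by linarith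
  have q2 : e.1 2 = ((z 0 * w 3 + z 1 * w 2) - (z 2 * w 1 + z 3 * w 0)) / 2 := by linarith
  have q3 : e.1 3 = -((z 0 * w 2 - z 1 * w 3) + (z 2 * w 0 - z 3 * w 1)) / 2 := by linarith
  ext i
  all_goals
    fin_cases i <;> simp only [proj, hopf, pluecker, Matrix.cons_val, Fin.zero_eta, Fin.mk_one,
      Fin.reduceFinMk, p0, p1, p2, p3, q0, q1, q2, q3]
  · linear_combination (z 0 * z 2 + z 1 * z 3) * hw
  · linear_combination (z 0 * z 3 - z 1 * z 2) * hw
  · linear_combination (z 0 ^ 2 + z 1 ^ 2 - z 2 ^ 2 - z 3 ^ 2) / 2 * hw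
  · linear_combination (w 0 * w 2 + w 1 * w 3) * hz
  · linear_combination (w 0 * w 3 - w 1 * w 2) * hz
  · linear_combination (w 0 ^ 2 + w 1 ^ 2 - w 2 ^ 2 - w 3 ^ 2) / 2 * hz

/-! ### Legendrian tori

Maps from the torus `ℝ² / ℤ²` are `ℤ²`-periodic maps on `ℝ × ℝ`. -/

/-- `f` is a smooth map from the torus `ℝ² / ℤ²`. -/
structure IsTorusMap {E : Type*} [NormedAddCommGroup E] [NormedSpace ℝ E] (f : ℝ × ℝ → E) : Prop where
  smooth : ContDiff ℝ ∞ f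
  periodic : ∀ x : ℝ × ℝ, ∀ m n : ℤ, f (x + ((m : ℝ), (n : ℝ))) = f x

/-- `f` is a Legendrian embedding of the torus into `(UT*S³, p dq)`. -/
structure IsLegendrianEmbedding (f : ℝ × ℝ → V4 × V4) : Prop where
  torusMap : IsTorusMap f
  mem : ∀ x, f x ∈ UTS3
  legendrian : ∀ x v, alpha (f x) (fderiv ℝ f x v) = 0
  immersion : ∀ x, Function.Injective (fderiv ℝ f x)
  injective : ∀ x y, f x = f y → ∃ m n : ℤ, y - x = ((m : ℝ), (n : ℝ))

/-- The Legendrian tori `Λ₀` and `Λ₁` are Legendrian isotopic: they are the ends of a smooth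
one-parameter family of Legendrian embeddings. -/
def LegendrianIsotopic (Λ₀ Λ₁ : Set (V4 × V4)) : Prop :=
  ∃ F : ℝ → ℝ × ℝ → V4 × V4,
    ContDiffOn ℝ ∞ (fun x : ℝ × (ℝ × ℝ) => F x.1 x.2) (Icc 0 1 ×ˢ univ) ∧
    (∀ t ∈ Icc (0 : ℝ) 1, IsLegendrianEmbedding (F t)) ∧ range (F 0) = Λ₀ ∧ range (F 1) = Λ₁

/-! ### The canonical Bohr–Sommerfeld cover -/

/-- A disc in `ℂP¹ × ℂP¹` in polar coordinates: the radius is `s ∈ [0, 1]` and the angle is `2 π θ`, where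
`θ ∈ [0, 1]`. Its boundary is the loop `θ ↦ u (1, θ)`. -/
structure IsDisc (u : ℝ × ℝ → V3 × V3) : Prop where
  smooth : ContDiff ℝ ∞ u
  mem : ∀ s ∈ Icc (0 : ℝ) 1, ∀ θ ∈ Icc (0 : ℝ) 1, u (s, θ) ∈ M
  centre : ∀ θ ∈ Icc (0 : ℝ) 1, u (0, θ) = u (0, 0)
  closes : ∀ s ∈ Icc (0 : ℝ) 1, u (s, 0) = u (s, 1)

/-- The symplectic area `∫ u^* ω` of a disc. -/
noncomputable def area (u : ℝ × ℝ → V3 × V3) : ℝ :=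
  ∫ s in (0 : ℝ)..1, ∫ θ in (0 : ℝ)..1,
    omega (u (s, θ)) (fderiv ℝ u (s, θ) (1, 0)) (fderiv ℝ u (s, θ) (0, 1))

/-- The symplectic action class of `L` takes values in `(π / k) ℤ`. As `ℂP¹ × ℂP¹` is simply connected,
the relative second homology of a connected `L` is generated by discs with boundary on `L`. -/
def ActionIn (L : Set (V3 × V3)) (k : ℕ) : Prop :=
  ∀ u, IsDisc u → (∀ θ ∈ Icc (0 : ℝ) 1, u (1, θ) ∈ L) → ∃ n : ℤ, area u = n * (Real.pi / k)

/-- `ι` is the canonical `k`-fold Bohr–Sommerfeld cover of the Lagrangian torus `L`, as an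
immersion of a torus with image `L`: the number `k` is minimal such that the action class of `L` takes
values in `(π / k) ℤ`, and a loop in `L` lifts to a closed path in the cover if and only if
the symplectic area that it bounds is in `π ℤ`. -/
structure IsCanonicalCover (L : Set (V3 × V3)) (k : ℕ) (ι : ℝ × ℝ → V3 × V3) : Prop where
  minimal : IsLeast {j : ℕ | 1 ≤ j ∧ ActionIn L j} k
  torusMap : IsTorusMap ι
  immersion : ∀ x, Function.Injective (fderiv ℝ ι x)
  image : range ι = L
  sheets : ∀ y ∈ L, {x ∈ Ico (0 : ℝ) 1 ×ˢ Ico (0 : ℝ) 1 | ι x = y}.ncard = k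
  loops : ∀ γ : ℝ → ℝ × ℝ, ContDiff ℝ ∞ γ → ι (γ 0) = ι (γ 1) →
    ∀ u, IsDisc u → (∀ θ ∈ Icc (0 : ℝ) 1, u (1, θ) = ι (γ θ)) →
      ((∃ m n : ℤ, γ 1 - γ 0 = ((m : ℝ), (n : ℝ))) ↔ ∃ n : ℤ, area u = n * Real.pi)

/-- `f` is a Legendrian lift of the immersion `ι` of the torus to `UT*S³`. -/
structure IsLegendrianLift (ι : ℝ × ℝ → V3 × V3) (f : ℝ × ℝ → V4 × V4) : Prop where
  torusMap : IsTorusMap f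
  mem : ∀ x, f x ∈ UTS3
  legendrian : ∀ x v, alpha (f x) (fderiv ℝ f x v) = 0
  lift : ∀ x, proj (f x) = ι x

/-! ### Conormal lifts and the unknot -/

/-- The conormal lift of a submanifold `K ⊂ S³`: the unit covectors over `K` that vanish on the velocity
vectors of all smooth curves in `K`. -/
def conormalLift (K : Set V4) : Set (V4 × V4) :=
  {e | e ∈ UTS3 ∧ e.1 ∈ K ∧
    ∀ c : ℝ → V4, ContDiff ℝ ∞ c → (∀ t, c t ∈ K) → c 0 = e.1 → ⟪e.2, deriv c 0⟫ = 0}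

/-- A smooth isotopy of diffeomorphisms of `S³` that starts at the identity. -/
structure IsAmbientIsotopy (φ : ℝ → V4 → V4) : Prop where
  smooth : ContDiffOn ℝ ∞ (fun x : ℝ × V4 => φ x.1 x.2) (Icc 0 1 ×ˢ S3)
  start : ∀ x ∈ S3, φ 0 x = x
  bijOn : ∀ t ∈ Icc (0 : ℝ) 1, BijOn (φ t) S3 S3
  inverse_smooth : ∀ t ∈ Icc (0 : ℝ) 1,
    ∃ ψ : V4 → V4, ContDiffOn ℝ ∞ ψ S3 ∧ ∀ x ∈ S3, ψ (φ t x) = x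

/-- A great circle of `S³`. -/
def greatCircle : Set V4 := {q | q ∈ S3 ∧ q 2 = 0 ∧ q 3 = 0}

/-- `K` is a smooth unknot in `S³`. -/
def IsUnknot (K : Set V4) : Prop := ∃ φ, IsAmbientIsotopy φ ∧ φ 1 '' greatCircle = K

end UnknotLift

namespace UnknotLift

/-! ### The prequantisation bundle -/

/-! The bivector $q\wedge p$ records an oriented plane, and the geodesic flow rotates $(2q,p)$
inside that plane through the angle $2t$. Hence the fibres of the projection are exactly the orbits,
and the period is $\pi$. The curvature identity is polynomial: `omega_proj` writes the cubic form on
bivectors through inner products, and the tangency relations reduce it to `dalpha`.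

The model lift is `greatTorus`, the conormal torus of a great circle: $q$ turns by the angle $2\pi
a$ in one coordinate plane and $p$ by $2\pi b$ in the orthogonal one. The two factors of its
projection turn with $a+b$ and $b-a$, so it covers the product torus twice, with deck translation
$(1/2,1/2)$.

Areas enter only modulo $\pi$. A disc in the sphere lifts, circle by circle, to the unit sphere of
$\mathbb{C}^2$. Stokes' theorem identifies twice its area with the action of the lifted boundary,
and over the equator that action is twice the area swept by the boundary in the plane, up to
$2\pi\mathbb{Z}$ (`IsDisc.exists_area_eq`). If the boundary lifts to a curve in the model torus, the
area is $-2\int (q_0\,dq_1-q_1\,dq_0)$ modulo $\pi$, that is $-\pi\,\Delta a$. This vanishes modulo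
$\pi$ exactly when the curve closes up upstairs.

For an arbitrary lift $f$, a time of the Reeb flow moves one point onto the model torus. Over the
product torus the components of $q$ and $p$ in each of the two coordinate planes are parallel;
together with the Legendrian condition this makes $q_0^2+q_1^2$ constant, so the whole moved lift
lies in the model torus (`mem_range_greatTorus_of_legendrian`). The area criterion then gives
injectivity, and counting sheets gives equality of images (`IsLegendrianLift.embedding`).

Finally, an ambient isotopy from the great circle to $K$ acts on unit covectors by normalised
inverse transposes. Its cotangent lift moves the model torus to $\Lambda_K$ through Legendrian
embeddings, while the Reeb time is run down to zero. -/

theorem inner_V4 (x y : V4) : ⟪x, y⟫ = x 0 * y 0 + x 1 * y 1 + x 2 * y 2 + x 3 * y 3 := by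
  simp [PiLp.inner_apply, Fin.sum_univ_four, mul_comm]

theorem exists_cos_sin {a b : ℝ} (h : a ^ 2 + b ^ 2 = 1) : ∃ t, Real.cos t = a ∧ Real.sin t = b := by
  have hn : ‖(⟨a, b⟩ : ℂ)‖ = 1 := by
    rw [← pow_eq_one_iff_of_nonneg (norm_nonneg _) two_ne_zero, ← Complex.normSq_eq_norm_sq,
      Complex.normSq_mk]
    linarith
  have h0 : (⟨a, b⟩ : ℂ) ≠ 0 := fun h0 => by simp [h0] at hn
  refine ⟨Complex.arg ⟨a, b⟩, ?_, ?_⟩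
  · rw [Complex.cos_arg h0, hn, div_one]
  · rw [Complex.sin_arg, hn, div_one]

theorem mem_S3 {q : V4} : q ∈ S3 ↔ ⟪q, q⟫ = 1 / 4 := by
  rw [real_inner_self_eq_norm_sq, S3, mem_ofPred_eq]
  constructor
  · intro h; rw [h]; norm_num
  · intro h; nlinarith [norm_nonneg q]

theorem mem_UTS3 {e : V4 × V4} :
    e ∈ UTS3 ↔ ⟪e.1, e.1⟫ = 1 / 4 ∧ ⟪e.1, e.2⟫ = 0 ∧ ⟪e.2, e.2⟫ = 1 := by
  rw [UTS3, mem_ofPred_eq, mem_S3, real_inner_self_eq_norm_sq e.2,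
    pow_eq_one_iff_of_nonneg (norm_nonneg _) two_ne_zero]

theorem contDiff_proj : ContDiff ℝ ∞ proj := by
  unfold proj pluecker
  refine ContDiff.prodMk ?_ ?_ <;>
  · rw [contDiff_euclidean]
    intro i
    fin_cases i <;> simp <;> fun_prop

/-- The polarisation of the quadratic map `proj`. -/
theorem fderiv_proj (e v : V4 × V4) : fderiv ℝ proj e v = proj (e.1, v.2) + proj (v.1, e.2) := by
  rw [← (contDiff_proj.differentiable (by simp) e).lineDeriv_eq_fderiv]
  refine HasLineDerivAt.lineDeriv ?_
  set D := proj (e.1, v.2) + proj (v.1, e.2) with hD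
  have h : (fun t : ℝ => proj (e + t • v)) = fun t => proj e + t • D + t ^ 2 • proj v := by
    funext t
    ext i <;> fin_cases i <;> simp [proj, pluecker, hD] <;> ring
  have h1 : HasDerivAt (fun t : ℝ => t • D) ((1 : ℝ) • D) 0 := (hasDerivAt_id (0 : ℝ)).smul_const D
  have h2 : HasDerivAt (fun t : ℝ => t ^ 2 • proj v) ((0 : ℝ) • proj v) 0 := by
    simpa using (hasDerivAt_pow 2 (0 : ℝ)).smul_const (proj v)
  have h3 := (h1.const_add (proj e)).add h2
  rw [one_smul, zero_smul, add_zero] at h3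
  rw [HasLineDerivAt, h]
  exact h3

/-- The triple product of bivectors in terms of inner products. -/
theorem omega_proj (a b c d e f : V4) :
    omega (proj (a, b)) (proj (c, d)) (proj (e, f)) =
      -4 * (⟪b, c⟫ * (⟪d, e⟫ * ⟪f, a⟫ - ⟪d, f⟫ * ⟪e, a⟫) - ⟪b, d⟫ * (⟪c, e⟫ * ⟪f, a⟫ - ⟪c, f⟫ * ⟪e, a⟫)
        - ⟪a, c⟫ * (⟪d, e⟫ * ⟪f, b⟫ - ⟪d, f⟫ * ⟪e, b⟫)
        + ⟪a, d⟫ * (⟪c, e⟫ * ⟪f, b⟫ - ⟪c, f⟫ * ⟪e, b⟫)) := by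
  simp only [inner_V4, omega, omegaFS, proj, pluecker, Matrix.cons_val]
  ring

theorem omega_add_left (m u u' v : V3 × V3) : omega m (u + u') v = omega m u v + omega m u' v := by
  simp only [omega, omegaFS, Prod.fst_add, Prod.snd_add, PiLp.add_apply]
  ring

theorem omega_add_right (m u v v' : V3 × V3) : omega m u (v + v') = omega m u v + omega m u v' := by
  simp only [omega, omegaFS, Prod.fst_add, Prod.snd_add, PiLp.add_apply]
  ring

/-- Each derivative of the quadratic map is a sum of two bivectors, so bilinearity leaves four
triple products. The tangency relations, in particular $\langle q,u_2\rangle=-\langle p,u_1\rangle$,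
then evaluate all inner products except those in `dalpha`. -/
theorem proj_curvature {e u v : V4 × V4} (he : e ∈ UTS3) (hu : u ∈ tangentUTS3 e)
    (hv : v ∈ tangentUTS3 e) :
    omega (proj e) (fderiv ℝ proj e u) (fderiv ℝ proj e v) = dalpha u v := by
  obtain ⟨q, p⟩ := e
  obtain ⟨u1, u2⟩ := u
  obtain ⟨v1, v2⟩ := v
  rw [mem_UTS3] at he
  obtain ⟨qq, qp, pp⟩ := he
  obtain ⟨a1, a2, a3⟩ := hu
  obtain ⟨b1, b2, b3⟩ := hv
  simp only at qq qp pp a1 a2 a3 b1 b2 b3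
  rw [fderiv_proj, fderiv_proj, omega_add_left, omega_add_right, omega_add_right]
  simp only [omega_proj, dalpha]
  have sym : ∀ {x y : V4} {r : ℝ}, ⟪x, y⟫ = r → ⟪y, x⟫ = r := fun h => by rw [real_inner_comm, h]
  have pu : ⟪u1, p⟫ = ⟪p, u1⟫ := real_inner_comm _ _
  have pv : ⟪v1, p⟫ = ⟪p, v1⟫ := real_inner_comm _ _
  have e1 : ⟪q, u2⟫ = -⟪p, u1⟫ := by linarith
  have e2 : ⟪q, v2⟫ = -⟪p, v1⟫ := by linarith
  simp only [qq, qp, pp, sym qp, a1, a3, b1, b3, e1, e2, sym a1, sym a3, sym b1, sym b3, sym e1, sym e2,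
    pu, pv, real_inner_comm u1 v2]
  ring

theorem proj_image : proj '' UTS3 = M := by
  have hopf_mem : ∀ z : V4, ‖z‖ = 1 → hopf z ∈ CP1 := fun z hz => hopf_image ▸ mem_image_of_mem _ hz
  ext m
  constructor
  · rintro ⟨e, he, rfl⟩
    rw [mem_UTS3] at he
    obtain ⟨qq, qp, pp⟩ := he
    simp only [inner_V4] at qq qp pp
    simp only [M, mem_ofPred_eq, mem_CP1, proj, pluecker, Matrix.cons_val]
    -- Both components have squared norm $|q|^2|p|^2-\langle q,p\rangle^2$: the cross terms cancel
    -- by the Plücker relation $m_{01}m_{23}-m_{02}m_{13}+m_{03}m_{12}=0$.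
    constructor <;>
    linear_combination (e.2 0 * e.2 0 + e.2 1 * e.2 1 + e.2 2 * e.2 2 + e.2 3 * e.2 3) * qq + 1 / 4 * pp
      - (e.1 0 * e.2 0 + e.1 1 * e.2 1 + e.1 2 * e.2 2 + e.1 3 * e.2 3) * qp
  · rintro ⟨hx, hy⟩
    rw [← hopf_image] at hx hy
    obtain ⟨z, hz, hzx⟩ := hx
    obtain ⟨w, hw, hwy⟩ := hy
    -- The preimage is found by solving $\tfrac12(\cdots)=zw^T$ for $W=p+2iq$ and separating real
    -- and imaginary parts.
    refine ⟨(!₂[((z 0 * w 1 + z 1 * w 0) + (z 2 * w 3 + z 3 * w 2)) / 2,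
      ((z 2 * w 2 - z 3 * w 3) - (z 0 * w 0 - z 1 * w 1)) / 2,
      ((z 0 * w 3 + z 1 * w 2) - (z 2 * w 1 + z 3 * w 0)) / 2,
      -((z 0 * w 2 - z 1 * w 3) + (z 2 * w 0 - z 3 * w 1)) / 2],
      !₂[(z 0 * w 0 - z 1 * w 1) + (z 2 * w 2 - z 3 * w 3),
      (z 0 * w 1 + z 1 * w 0) - (z 2 * w 3 + z 3 * w 2),
      (z 0 * w 2 - z 1 * w 3) - (z 2 * w 0 - z 3 * w 1),
      (z 0 * w 3 + z 1 * w 2) + (z 2 * w 1 + z 3 * w 0)]), ?_, ?_⟩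
    · have hz' := norm_V4_one.1 hz
      have hw' := norm_V4_one.1 hw
      rw [mem_UTS3]
      simp only [inner_V4, Matrix.cons_val]
      refine ⟨?_, by ring, ?_⟩
      · linear_combination 1 / 4 * (w 0 ^ 2 + w 1 ^ 2 + w 2 ^ 2 + w 3 ^ 2) * hz' + 1 / 4 * hw'
      · linear_combination (w 0 ^ 2 + w 1 ^ 2 + w 2 ^ 2 + w 3 ^ 2) * hz' + hw'
    · rw [proj_eq_hopf hz hw, hzx, hwy]
      ext i j
      fin_cases i <;> fin_cases j <;>
        simp [segreMatrix, toC, Complex.ext_iff, Matrix.vecMulVec_apply] <;> constructor <;> ring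

/-! ### The Reeb flow and the fibres of the projection -/

theorem inner_reebFlow (t : ℝ) (e e' : V4 × V4) :
    ⟪(reebFlow t e).1, (reebFlow t e').1⟫ = Real.cos (2 * t) ^ 2 * ⟪e.1, e'.1⟫
      + Real.cos (2 * t) * (Real.sin (2 * t) / 2) * (⟪e.1, e'.2⟫ + ⟪e.2, e'.1⟫)
      + Real.sin (2 * t) ^ 2 / 4 * ⟪e.2, e'.2⟫ ∧
    ⟪(reebFlow t e).1, (reebFlow t e').2⟫ = -2 * Real.cos (2 * t) * Real.sin (2 * t) * ⟪e.1, e'.1⟫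
      + Real.cos (2 * t) ^ 2 * ⟪e.1, e'.2⟫ - Real.sin (2 * t) ^ 2 * ⟪e.2, e'.1⟫
      + Real.cos (2 * t) * (Real.sin (2 * t) / 2) * ⟪e.2, e'.2⟫ ∧
    ⟪(reebFlow t e).2, (reebFlow t e').2⟫ = 4 * Real.sin (2 * t) ^ 2 * ⟪e.1, e'.1⟫
      - 2 * Real.cos (2 * t) * Real.sin (2 * t) * (⟪e.1, e'.2⟫ + ⟪e.2, e'.1⟫)
      + Real.cos (2 * t) ^ 2 * ⟪e.2, e'.2⟫ := by
  simp only [reebFlow, inner_add_left, inner_add_right, real_inner_smul_left, real_inner_smul_right]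
  refine ⟨?_, ?_, ?_⟩ <;> ring

theorem reebFlow_mem {e : V4 × V4} (he : e ∈ UTS3) (t : ℝ) : reebFlow t e ∈ UTS3 := by
  rw [mem_UTS3] at he ⊢
  obtain ⟨qq, qp, pp⟩ := he
  have pq : ⟪e.2, e.1⟫ = 0 := by rw [real_inner_comm, qp]
  obtain ⟨h1, h2, h3⟩ := inner_reebFlow t e e
  have cs := Real.cos_sq_add_sin_sq (2 * t)
  rw [h1, h2, h3, qq, qp, pp, pq]
  refine ⟨by linear_combination 1 / 4 * cs, by ring, by linear_combination cs⟩

theorem reebFlow_add (s t : ℝ) (e : V4 × V4) : reebFlow (s + t) e = reebFlow s (reebFlow t e) := by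
  ext i <;> simp [reebFlow, mul_add, Real.cos_add, Real.sin_add] <;> ring

theorem reebFlow_zero (e : V4 × V4) : reebFlow 0 e = e := by simp [reebFlow]

theorem reebFlow_neg_reebFlow (t : ℝ) (e : V4 × V4) : reebFlow (-t) (reebFlow t e) = e := by
  rw [← reebFlow_add, neg_add_cancel, reebFlow_zero]

theorem proj_reebFlow (t : ℝ) (e : V4 × V4) : proj (reebFlow t e) = proj e := by
  have key : ∀ i j, pluecker (reebFlow t e) i j = pluecker e i j := by
    intro i j
    simp only [pluecker, reebFlow, PiLp.add_apply, PiLp.smul_apply, smul_eq_mul]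
    linear_combination (e.1 i * e.2 j - e.1 j * e.2 i) * Real.cos_sq_add_sin_sq (2 * t)
  simp only [proj, key]

theorem reebFlow_eq_self_iff {e : V4 × V4} (he : e ∈ UTS3) (t : ℝ) :
    reebFlow t e = e ↔ ∃ n : ℤ, t = n * Real.pi := by
  rw [mem_UTS3] at he
  constructor
  · intro h
    have h1 : ⟪e.1, (reebFlow t e).1⟫ = ⟪e.1, e.1⟫ := by rw [h]
    simp only [reebFlow, inner_add_right, real_inner_smul_right, he.1, he.2.1] at h1
    obtain ⟨n, hn⟩ := (Real.cos_eq_one_iff (2 * t)).1 (by linarith)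
    exact ⟨n, by linarith⟩
  · rintro ⟨n, rfl⟩
    have h1 : Real.cos (2 * (n * Real.pi)) = 1 := (Real.cos_eq_one_iff _).2 ⟨n, by ring⟩
    have h2 : Real.sin (2 * (n * Real.pi)) = 0 := by
      have := Real.cos_sq_add_sin_sq (2 * (n * Real.pi))
      rw [h1] at this
      nlinarith
    simp [reebFlow, h1, h2]

theorem exists_reebFlow_of_proj_eq {e e' : V4 × V4} (he : e ∈ UTS3) (he' : e' ∈ UTS3)
    (h : proj e = proj e') : ∃ t, e' = reebFlow t e := by
  have hm : ∀ i j, pluecker e i j = pluecker e' i j := by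
    simp only [proj, Prod.mk.injEq] at h
    obtain ⟨h1, h2⟩ := h
    have f := fun i => congrFun (congrArg WithLp.ofLp h1) i
    have g := fun i => congrFun (congrArg WithLp.ofLp h2) i
    have f0 := f 0; have f1 := f 1; have f2 := f 2
    have g0 := g 0; have g1 := g 1; have g2 := g 2
    simp only [Matrix.cons_val, pluecker] at f0 f1 f2 g0 g1 g2
    intro i j
    fin_cases i <;> fin_cases j <;> simp [pluecker] <;> linarith
  obtain ⟨qq, qp, pp⟩ := mem_UTS3.1 he
  obtain ⟨qq', qp', pp'⟩ := mem_UTS3.1 he'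
  -- Contracting $q\wedge p=q'\wedge p'$ with $p'$ expresses $q'$ in terms of $q$ and $p$;
  -- contracting with $q'$ does the same for $p'$.
  have k1 : e'.1 = ⟪e.2, e'.2⟫ • e.1 + (-⟪e.1, e'.2⟫) • e.2 := by
    ext i
    have m0 := hm i 0; have m1 := hm i 1; have m2 := hm i 2; have m3 := hm i 3
    simp only [inner_V4, pluecker, PiLp.add_apply, PiLp.smul_apply, smul_eq_mul] at *
    linear_combination (-e'.1 i) * pp' + e'.2 i * qp' - e'.2 0 * m0 - e'.2 1 * m1 - e'.2 2 * m2
      - e'.2 3 * m3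
  have k2 : e'.2 = (-4 * ⟪e.2, e'.1⟫) • e.1 + (4 * ⟪e.1, e'.1⟫) • e.2 := by
    ext i
    have m0 := hm i 0; have m1 := hm i 1; have m2 := hm i 2; have m3 := hm i 3
    simp only [inner_V4, pluecker, PiLp.add_apply, PiLp.smul_apply, smul_eq_mul] at *
    linear_combination (-4 * e'.2 i) * qq' + 4 * e'.1 i * qp' + 4 * e'.1 0 * m0 + 4 * e'.1 1 * m1
      + 4 * e'.1 2 * m2 + 4 * e'.1 3 * m3
  have pq : ⟪e.2, e.1⟫ = 0 := by rw [real_inner_comm, qp]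
  have l1 : ⟪e.1, e'.1⟫ = ⟪e.2, e'.2⟫ / 4 := by
    conv_lhs => rw [k1]
    simp only [inner_add_right, real_inner_smul_right, qq, qp]
    ring
  have l2 : ⟪e.2, e'.1⟫ = -⟪e.1, e'.2⟫ := by
    conv_lhs => rw [k1]
    simp only [inner_add_right, real_inner_smul_right, pp, pq]
    ring
  -- The condition $|q'|^2=1/4$ puts the coefficients on the unit circle, which supplies the
  -- rotation angle.
  have hcs : ⟪e.2, e'.2⟫ ^ 2 + (-2 * ⟪e.1, e'.2⟫) ^ 2 = 1 := by
    have h2 := qq'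
    rw [k1] at h2
    simp only [inner_add_left, inner_add_right, real_inner_smul_right, real_inner_smul_left, qq, qp,
      pp, pq] at h2
    linarith
  obtain ⟨t, hc, hs⟩ := exists_cos_sin hcs
  refine ⟨t / 2, ?_⟩
  have ht : 2 * (t / 2) = t := by ring
  rw [l1, l2] at k2
  refine Prod.ext ?_ ?_
  · rw [reebFlow, ht, hc, hs]
    conv_lhs => rw [k1]
    congr 2
    ring
  · rw [reebFlow, ht, hc, hs]
    conv_lhs => rw [k2]
    congr 2 <;> ring

theorem isPrequantisation_proj : IsPrequantisation proj where
  smooth := contDiff_proj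
  image := proj_image
  flow_mem t _ he := reebFlow_mem he t
  flow_zero := reebFlow_zero
  flow_deriv e t := by
    have hl : HasDerivAt (fun s : ℝ => 2 * s) 2 t := by simpa using (hasDerivAt_id t).const_mul 2
    have hc : HasDerivAt (fun s => Real.cos (2 * s)) (-Real.sin (2 * t) * 2) t :=
      (Real.hasDerivAt_cos (2 * t)).comp t hl
    have hs : HasDerivAt (fun s => Real.sin (2 * s)) (Real.cos (2 * t) * 2) t :=
      (Real.hasDerivAt_sin (2 * t)).comp t hl
    have h1 := (hc.smul_const e.1).add ((hs.div_const 2).smul_const e.2)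
    have h2 := ((hs.const_mul 2).neg.smul_const e.1).add (hc.smul_const e.2)
    refine HasDerivAt.congr_deriv (f := fun s => reebFlow s e) (h1.prodMk h2) ?_
    refine Prod.ext ?_ ?_ <;> simp only [reebFlow, smul_add, smul_smul] <;> congr 2 <;> ring
  reeb_alpha e he := by rw [alpha]; exact (mem_UTS3.1 he).2.2
  reeb_dalpha e he v hv := by
    simp only [dalpha, real_inner_smul_left]
    obtain ⟨h1, h2, h3⟩ := hv
    rw [h1, real_inner_comm, h3]
    ring
  free _ he := reebFlow_eq_self_iff he
  fibre e he e' he' :=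
    ⟨exists_reebFlow_of_proj_eq he he', by rintro ⟨t, rfl⟩; exact (proj_reebFlow t e).symm⟩
  curvature _ he _ hu _ hv := proj_curvature he hu hv

/-! ### Areas of discs and winding numbers -/

/-- A closed plane curve on the circle `x² + y² = r` sweeps out an area in `π r ℤ`. -/
theorem exists_winding {x y : ℝ → ℝ} {r : ℝ} (hr : 0 < r) (hx : ContDiff ℝ ∞ x) (hy : ContDiff ℝ ∞ y)
    (h : ∀ t ∈ Icc (0 : ℝ) 1, x t ^ 2 + y t ^ 2 = r) (hx1 : x 1 = x 0) (hy1 : y 1 = y 0) :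
    ∃ n : ℤ, ∫ t in (0 : ℝ)..1, (x t * deriv y t - y t * deriv x t) = r * (2 * Real.pi * n) := by
  have dx : ∀ t, HasDerivAt x (deriv x t) t := fun t => (hx.differentiable (by simp) t).hasDerivAt
  have dy : ∀ t, HasDerivAt y (deriv y t) t := fun t => (hy.differentiable (by simp) t).hasDerivAt
  have cx : Continuous (deriv x) := hx.continuous_deriv (by simp)
  have cy : Continuous (deriv y) := hy.continuous_deriv (by simp)
  have hc : Continuous fun t => x t * deriv y t - y t * deriv x t :=
    (hx.continuous.mul cy).sub (hy.continuous.mul cx)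
  -- The polar angle relative to the starting point. The curve rotated back by `φ` will be constant.
  set φ : ℝ → ℝ := fun s => (∫ t in (0 : ℝ)..s, (x t * deriv y t - y t * deriv x t)) / r with hφ
  have dφ : ∀ t, HasDerivAt φ ((x t * deriv y t - y t * deriv x t) / r) t := fun t =>
    (hc.integral_hasStrictDerivAt 0 t).hasDerivAt.div_const r
  have φ0 : φ 0 = 0 := by simp [hφ]
  have dcos := fun t => (Real.hasDerivAt_cos (φ t)).comp t (dφ t)
  have dsin := fun t => (Real.hasDerivAt_sin (φ t)).comp t (dφ t)
  -- The circle equation is known only on the unit interval, so it is differentiated from the right.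
  have tangent : ∀ t ∈ Ico (0 : ℝ) 1, x t * deriv x t + y t * deriv y t = 0 := by
    intro t ht
    have h1 : HasDerivWithinAt (fun t => x t ^ 2 + y t ^ 2) (2 * x t * deriv x t + 2 * y t * deriv y t)
        (Ici t) t := by
      exact ((((dx t).pow 2).add ((dy t).pow 2)).congr_deriv (by simp)).hasDerivWithinAt
    have h2 : HasDerivWithinAt (fun t => x t ^ 2 + y t ^ 2) 0 (Ici t) t := by
      refine (hasDerivWithinAt_const t (Ici t) r).congr_of_eventuallyEq ?_ (h t ⟨ht.1, ht.2.le⟩)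
      filter_upwards [Icc_mem_nhdsGE ht.2] with s hs
      exact h s ⟨ht.1.trans hs.1, hs.2⟩
    have := (uniqueDiffOn_Ici t t self_mem_Ici).eq_deriv _ h1 h2
    linarith
  have key : ∀ a b : ℝ → ℝ, (∀ t, HasDerivAt a (b t) t) → (∀ t ∈ Ico (0 : ℝ) 1, b t = 0) →
      a 1 = a 0 := by
    intro a b hab hb
    refine constant_of_has_deriv_right_zero (fun t _ => (hab t).continuousAt.continuousWithinAt) ?_ 1
      ⟨zero_le_one, le_rfl⟩
    intro t ht
    rw [← hb t ht]
    exact (hab t).hasDerivWithinAt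
  -- Real and imaginary parts of $(x+iy)e^{-i\varphi}$. As the curve is closed, their constancy
  -- forces $e^{i\varphi(1)}=1$.
  have h1 := key (fun t => x t * Real.cos (φ t) + y t * Real.sin (φ t)) _
    (fun t => ((dx t).mul (dcos t)).add ((dy t).mul (dsin t))) (by
      intro t ht
      have e := h t ⟨ht.1, ht.2.le⟩
      have e' := tangent t ht
      simp only [Function.comp]
      field_simp
      linear_combination (-deriv x t * Real.cos (φ t) - deriv y t * Real.sin (φ t)) * e
        + (x t * Real.cos (φ t) + y t * Real.sin (φ t)) * e')
  have h2 := key (fun t => y t * Real.cos (φ t) - x t * Real.sin (φ t)) _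
    (fun t => ((dy t).mul (dcos t)).sub ((dx t).mul (dsin t))) (by
      intro t ht
      have e := h t ⟨ht.1, ht.2.le⟩
      have e' := tangent t ht
      simp only [Function.comp]
      field_simp
      linear_combination (-deriv y t * Real.cos (φ t) + deriv x t * Real.sin (φ t)) * e
        + (y t * Real.cos (φ t) - x t * Real.sin (φ t)) * e')
  simp only [φ0, Real.cos_zero, Real.sin_zero, hx1, hy1] at h1 h2
  have e0 := h 0 ⟨le_rfl, zero_le_one⟩
  have hcos : Real.cos (φ 1) = 1 := by
    have : r * (Real.cos (φ 1) - 1) = 0 := by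
      rw [← e0]
      linear_combination x 0 * h1 + y 0 * h2
    rcases mul_eq_zero.1 this with h' | h'
    · exact absurd h' hr.ne'
    · linarith
  obtain ⟨n, hn⟩ := (Real.cos_eq_one_iff _).1 hcos
  refine ⟨n, ?_⟩
  have : φ 1 * r = ∫ t in (0 : ℝ)..1, (x t * deriv y t - y t * deriv x t) := by
    simp only [hφ]
    field_simp
  rw [← this, ← hn]
  ring

/-! ### Hopf lifts and Stokes' theorem -/

/-- The standard symplectic form of `ℂ² = ℝ⁴`. -/
noncomputable def sympl : V4 →L[ℝ] V4 →L[ℝ] ℝ :=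
  (LinearMap.mk₂ ℝ (fun u v : V4 => u 0 * v 1 - u 1 * v 0 + (u 2 * v 3 - u 3 * v 2))
    (fun _ _ _ => by simp; ring) (fun _ _ _ => by simp; ring) (fun _ _ _ => by simp; ring)
    (fun _ _ _ => by simp; ring)).toContinuousBilinearMap

theorem sympl_apply (u v : V4) : sympl u v = u 0 * v 1 - u 1 * v 0 + (u 2 * v 3 - u 3 * v 2) := rfl

/-- Stokes' theorem on a rectangle for the pullback of `sympl`. -/
theorem sympl_stokes {z : ℝ × ℝ → V4} {U : Set (ℝ × ℝ)} (hU : IsOpen U) (hz : ContDiffOn ℝ ∞ z U)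
    {a b : ℝ} (hab : a ≤ b) (hsub : Icc a b ×ˢ Icc (0 : ℝ) 1 ⊆ U) :
    ∫ s in a..b, ∫ θ in (0 : ℝ)..1,
        2 * sympl (fderiv ℝ z (s, θ) (1, 0)) (fderiv ℝ z (s, θ) (0, 1)) =
      (∫ s in a..b, sympl (z (s, 0)) (fderiv ℝ z (s, 0) (1, 0)))
      - (∫ s in a..b, sympl (z (s, 1)) (fderiv ℝ z (s, 1) (1, 0)))
      + (∫ θ in (0 : ℝ)..1, sympl (z (b, θ)) (fderiv ℝ z (b, θ) (0, 1)))
      - ∫ θ in (0 : ℝ)..1, sympl (z (a, θ)) (fderiv ℝ z (a, θ) (0, 1)) := by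
  have hz' : ContDiffOn ℝ ∞ (fderiv ℝ z) U := hz.fderiv_of_isOpen hU (by simp)
  have d1 : ∀ p ∈ U, HasFDerivAt z (fderiv ℝ z p) p := fun p hp =>
    ((hz.contDiffAt (hU.mem_nhds hp)).differentiableAt (by simp)).hasFDerivAt
  have d2 : ∀ p ∈ U, HasFDerivAt (fderiv ℝ z) (fderiv ℝ (fderiv ℝ z) p) p := fun p hp =>
    ((hz'.contDiffAt (hU.mem_nhds hp)).differentiableAt (by simp)).hasFDerivAt
  have d3 : ∀ w, ∀ p ∈ U, HasFDerivAt (fun p => fderiv ℝ z p w)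
      ((ContinuousLinearMap.apply ℝ V4 w).comp (fderiv ℝ (fderiv ℝ z) p)) p := fun w p hp =>
    (ContinuousLinearMap.apply ℝ V4 w).hasFDerivAt.comp p (d2 p hp)
  have d4 := fun w p (hp : p ∈ U) => sympl.hasFDerivAt_of_bilinear (d1 p hp) (d3 w p hp)
  have hIcc : uIcc a b ×ˢ uIcc (0 : ℝ) 1 ⊆ U := by
    rwa [uIcc_of_le hab, uIcc_of_le zero_le_one]
  have hIoo : Ioo (min a b) (max a b) ×ˢ Ioo (min 0 1) (max (0 : ℝ) 1) ⊆ U :=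
    (prod_mono Ioo_subset_Icc_self Ioo_subset_Icc_self).trans hIcc
  have hcont : ∀ w, ContinuousOn (fun p => sympl (z p) (fderiv ℝ z p w)) U := fun w p hp =>
    (d4 w p hp).continuousAt.continuousWithinAt
  have hsymm : ∀ p ∈ U, ∀ v w, fderiv ℝ (fderiv ℝ z) p v w = fderiv ℝ (fderiv ℝ z) p w v := by
    intro p hp
    exact (hz.contDiffAt (hU.mem_nhds hp)).isSymmSndFDerivAt
      (by simp only [minSmoothness_of_isRCLikeNormedField]; exact ENat.LEInfty.out)
  -- Green's formula for $\beta=$ `sympl`$(z,dz)$: in $d\beta$ the second derivatives of $z$ cancel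
  -- by symmetry, leaving twice the pullback of `sympl`.
  have hdiv : ∀ p ∈ U, (sympl.precompR (ℝ × ℝ) (z p)
        ((ContinuousLinearMap.apply ℝ V4 (0, 1)).comp (fderiv ℝ (fderiv ℝ z) p))
        + sympl.precompL (ℝ × ℝ) (fderiv ℝ z p) (fderiv ℝ z p (0, 1))) (1, 0)
      + (-(sympl.precompR (ℝ × ℝ) (z p)
        ((ContinuousLinearMap.apply ℝ V4 (1, 0)).comp (fderiv ℝ (fderiv ℝ z) p))
        + sympl.precompL (ℝ × ℝ) (fderiv ℝ z p) (fderiv ℝ z p (1, 0)))) (0, 1)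
      = 2 * sympl (fderiv ℝ z p (1, 0)) (fderiv ℝ z p (0, 1)) := by
    intro p hp
    simp only [add_apply, neg_apply, ContinuousLinearMap.compL_apply,
      ContinuousLinearMap.precompR_apply, ContinuousLinearMap.precompL_apply,
      ContinuousLinearMap.comp_apply, ContinuousLinearMap.apply_apply, hsymm p hp (0, 1) (1, 0)]
    simp only [sympl_apply]
    ring
  have hst := MeasureTheory.integral2_divergence_prod_of_hasFDerivAt
    (fun p => sympl (z p) (fderiv ℝ z p (0, 1))) (fun p => -sympl (z p) (fderiv ℝ z p (1, 0)))
    _ _ a 0 b 1 ((hcont _).mono hIcc) ((hcont _).mono hIcc).neg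
    (fun p hp => d4 (0, 1) p (hIoo hp)) (fun p hp => (d4 (1, 0) p (hIoo hp)).neg) (by
      refine ContinuousOn.integrableOn_compact (isCompact_uIcc.prod isCompact_uIcc) ?_
      refine ContinuousOn.congr (f := fun p => 2 * sympl (fderiv ℝ z p (1, 0)) (fderiv ℝ z p (0, 1))) ?_
        fun p hp => hdiv p (hIcc hp)
      have h1 := fun w => ((hz'.continuousOn.mono hIcc).clm_apply (continuousOn_const (c := w)))
      exact continuousOn_const.mul ((sympl.continuous.comp_continuousOn (h1 _)).clm_apply (h1 _)))
  refine (intervalIntegral.integral_congr fun s hs => intervalIntegral.integral_congr fun θ hθ =>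
    (hdiv (s, θ) (hIcc ⟨hs, hθ⟩)).symm).trans (hst.trans ?_)
  simp only [intervalIntegral.integral_neg]
  ring

/-- The orthogonal projection of `ζ ∈ ℂ²` to the line `x ∈ ℂP¹`. -/
noncomputable def lineProj (x : V3) (ζ : V4) : V4 :=
  !₂[(1 / 2 + x 2) * ζ 0 + (x 0 * ζ 2 + x 1 * ζ 3), (1 / 2 + x 2) * ζ 1 + (x 0 * ζ 3 - x 1 * ζ 2),
    x 0 * ζ 0 - x 1 * ζ 1 + (1 / 2 - x 2) * ζ 2, x 0 * ζ 1 + x 1 * ζ 0 + (1 / 2 - x 2) * ζ 3]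

/-- The angle between two complex lines is half the spherical angle between the corresponding
points; in terms of vectors of length $1/2$ this reads $\cos^2=\tfrac12+2\langle x,y\rangle$. -/
theorem norm_lineProj_sq {x : V3} {ζ : V4} (hx : x ∈ CP1) (hζ : ‖ζ‖ = 1) :
    ‖lineProj x ζ‖ ^ 2 = 1 / 2 + 2 * (x 0 * hopf ζ 0 + x 1 * hopf ζ 1 + x 2 * hopf ζ 2) := by
  rw [mem_CP1] at hx
  rw [norm_V4_one] at hζ
  rw [norm_V4_sq]
  simp only [lineProj, hopf, Matrix.cons_val]
  linear_combination (ζ 0 ^ 2 + ζ 1 ^ 2 + ζ 2 ^ 2 + ζ 3 ^ 2) * hx + 1 / 2 * hζ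

theorem hopf_smul (c : ℝ) (ζ : V4) : hopf (c • ζ) = c ^ 2 • hopf ζ := by
  ext i
  fin_cases i <;> simp [hopf] <;> ring

theorem hopf_lineProj {x : V3} {ζ : V4} (hx : x ∈ CP1) (hζ : ‖ζ‖ = 1) :
    hopf (lineProj x ζ) = ‖lineProj x ζ‖ ^ 2 • x := by
  rw [norm_lineProj_sq hx hζ]
  rw [mem_CP1] at hx
  rw [norm_V4_one] at hζ
  ext i
  fin_cases i <;> simp only [lineProj, hopf, Matrix.cons_val, Fin.zero_eta, Fin.mk_one,
    Fin.reduceFinMk, PiLp.smul_apply, smul_eq_mul]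
  · linear_combination (-(ζ 0 * ζ 2 + ζ 1 * ζ 3)) * hx + x 0 / 2 * hζ
  · linear_combination (-(ζ 0 * ζ 3 - ζ 1 * ζ 2)) * hx + x 1 / 2 * hζ
  · linear_combination (-(ζ 0 ^ 2 + ζ 1 ^ 2 - ζ 2 ^ 2 - ζ 3 ^ 2) / 2) * hx + x 2 / 2 * hζ

theorem lineProj_hopf {ζ : V4} (hζ : ‖ζ‖ = 1) : lineProj (hopf ζ) ζ = ζ := by
  rw [norm_V4_one] at hζ
  ext i
  fin_cases i <;> simp only [lineProj, hopf, Matrix.cons_val, Fin.zero_eta, Fin.mk_one,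
    Fin.reduceFinMk]
  · linear_combination ζ 0 / 2 * hζ
  · linear_combination ζ 1 / 2 * hζ
  · linear_combination ζ 2 / 2 * hζ
  · linear_combination ζ 3 / 2 * hζ

/-- The projection vanishes only between orthogonal lines. These are antipodal points, at distance
$1$ on the sphere of radius $1/2$. -/
theorem lineProj_ne_zero {x : V3} {ζ : V4} (hx : x ∈ CP1) (hζ : ‖ζ‖ = 1) (h : ‖x - hopf ζ‖ < 1) :
    lineProj x ζ ≠ 0 := by
  intro h0
  have h1 := norm_lineProj_sq hx hζ
  rw [h0, norm_zero] at h1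
  have h2 : ‖x - hopf ζ‖ ^ 2 < 1 := by nlinarith [norm_nonneg (x - hopf ζ)]
  rw [norm_V3_sq] at h2
  have h3 : hopf ζ ∈ CP1 := hopf_image ▸ mem_image_of_mem _ hζ
  rw [mem_CP1] at hx h3
  simp only [PiLp.sub_apply] at h2
  nlinarith

/-- The area density of a map of the plane to `ℂP¹`. -/
noncomputable def density (W : ℝ × ℝ → V3) (p : ℝ × ℝ) : ℝ :=
  omegaFS (W p) (fderiv ℝ W p (1, 0)) (fderiv ℝ W p (0, 1))

theorem continuous_density {W : ℝ × ℝ → V3} (hW : ContDiff ℝ ∞ W) : Continuous (density W) := by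
  have h1 : Continuous (fderiv ℝ W) := hW.continuous_fderiv (by simp)
  have h2 := hW.continuous
  unfold density omegaFS
  fun_prop

theorem continuous_integral_density {W : ℝ × ℝ → V3} (hW : ContDiff ℝ ∞ W) :
    Continuous fun s => ∫ θ in (0 : ℝ)..1, density W (s, θ) :=
  intervalIntegral.continuous_parametric_intervalIntegral_of_continuous'
    (f := fun s θ => density W (s, θ)) (continuous_density hW) 0 1

/-- `ζ` is a closed lift to the unit sphere of the loop `c` in `ℂP¹`. -/
structure IsHopfLift (c : ℝ → V3) (ζ : ℝ → V4) : Prop where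
  smooth : ContDiff ℝ ∞ ζ
  norm : ∀ θ, ‖ζ θ‖ = 1
  lift : ∀ θ, hopf (ζ θ) = c θ
  closed : ζ 1 = ζ 0

theorem contDiff_hopf : ContDiff ℝ ∞ hopf := by
  rw [contDiff_euclidean]
  intro i
  fin_cases i <;> simp [hopf] <;> fun_prop

theorem contDiff_lineProj : ContDiff ℝ ∞ fun p : V3 × V4 => lineProj p.1 p.2 := by
  rw [contDiff_euclidean]
  intro i
  fin_cases i <;> simp [lineProj] <;> fun_prop

/-- For a map `z` to the unit sphere, the area density of `hopf ∘ z` is the pullback of `sympl`. -/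
theorem density_eq_sympl {W : ℝ × ℝ → V3} {z : ℝ × ℝ → V4} {U : Set (ℝ × ℝ)} (hU : IsOpen U)
    (hz : ContDiffOn ℝ ∞ z U) (hn : ∀ p ∈ U, ‖z p‖ = 1) (hW : ∀ p ∈ U, hopf (z p) = W p) {p : ℝ × ℝ}
    (hp : p ∈ U) : density W p = sympl (fderiv ℝ z p (1, 0)) (fderiv ℝ z p (0, 1)) := by
  have dz : DifferentiableAt ℝ z p := (hz.contDiffAt (hU.mem_nhds hp)).differentiableAt (by simp)
  have ht : ∀ w, ⟪z p, fderiv ℝ z p w⟫ = 0 := by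
    intro w
    have h1 := dz.hasFDerivAt.inner ℝ dz.hasFDerivAt
    have h2 : HasFDerivAt (fun p => ⟪z p, z p⟫) (0 : ℝ × ℝ →L[ℝ] ℝ) p := by
      refine (hasFDerivAt_const (1 : ℝ) p).congr_of_eventuallyEq ?_
      filter_upwards [hU.mem_nhds hp] with x hx
      rw [real_inner_self_eq_norm_sq, hn x hx, one_pow]
    have h3 := congrArg (fun l : ℝ × ℝ →L[ℝ] ℝ => l w) (h1.unique h2)
    simp [fderivInnerCLM_apply, real_inner_comm] at h3
    linarith
  have hf : fderiv ℝ W p = (fderiv ℝ hopf (z p)).comp (fderiv ℝ z p) := by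
    rw [← fderiv_comp p (contDiff_hopf.differentiable (by simp) _) dz]
    refine Filter.EventuallyEq.fderiv_eq ?_
    filter_upwards [hU.mem_nhds hp] with x hx
    exact (hW x hx).symm
  rw [density, hf, ← hW p hp, ContinuousLinearMap.comp_apply, ContinuousLinearMap.comp_apply,
    hopf_pullback (hn p hp) (ht _) (ht _), sympl_apply]

/-- A closed Hopf lift can be continued to nearby loops, and its action changes by the swept area. -/
theorem IsHopfLift.continue {W : ℝ × ℝ → V3} (hW : ContDiff ℝ ∞ W) (hmem : ∀ p, W p ∈ CP1)
    (hcl : ∀ s, W (s, 1) = W (s, 0)) {s₀ s₁ ε : ℝ} (h01 : s₀ ≤ s₁) (h1 : s₁ < s₀ + ε)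
    (hnear : ∀ s, |s - s₀| < ε → ∀ θ, ‖W (s, θ) - W (s₀, θ)‖ < 1) {ζ : ℝ → V4}
    (hζ : IsHopfLift (fun θ => W (s₀, θ)) ζ) :
    ∃ ζ', IsHopfLift (fun θ => W (s₁, θ)) ζ' ∧
      2 * (∫ s in s₀..s₁, ∫ θ in (0 : ℝ)..1, density W (s, θ)) =
        (∫ θ in (0 : ℝ)..1, sympl (ζ' θ) (deriv ζ' θ)) - ∫ θ in (0 : ℝ)..1, sympl (ζ θ) (deriv ζ θ) := by
  set U : Set (ℝ × ℝ) := {p | |p.1 - s₀| < ε} with hUdef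
  have hU : IsOpen U := isOpen_lt (by fun_prop) continuous_const
  -- The lift over the circle at `s₀` is carried to nearby circles by orthogonal projection to the
  -- moving line. Normalising gives `z`, which agrees with `ζ` at `s₀`.
  set Y : ℝ × ℝ → V4 := fun p => lineProj (W p) (ζ p.2) with hY
  have hYs : ContDiff ℝ ∞ Y := contDiff_lineProj.comp (hW.prodMk (hζ.smooth.comp contDiff_snd))
  have hY0 : ∀ p ∈ U, Y p ≠ 0 := by
    intro p hp
    refine lineProj_ne_zero (hmem p) (hζ.norm _) ?_
    rw [hζ.lift]
    exact hnear p.1 hp p.2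
  set z : ℝ × ℝ → V4 := fun p => ‖Y p‖⁻¹ • Y p with hzdef
  have hz : ContDiffOn ℝ ∞ z U := by
    have h2 := (hYs.contDiffOn (s := U)).norm ℝ hY0
    exact (h2.inv fun p hp => norm_ne_zero_iff.2 (hY0 p hp)).smul hYs.contDiffOn
  have hn : ∀ p ∈ U, ‖z p‖ = 1 := by
    intro p hp
    rw [hzdef, norm_smul, norm_inv, norm_norm, inv_mul_cancel₀ (norm_ne_zero_iff.2 (hY0 p hp))]
  have hl : ∀ p ∈ U, hopf (z p) = W p := by
    intro p hp
    rw [hzdef, hopf_smul, hY, hopf_lineProj (hmem p) (hζ.norm _), smul_smul, ← mul_pow,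
      inv_mul_cancel₀ (norm_ne_zero_iff.2 (hY0 p hp)), one_pow, one_smul]
  have hz0 : ∀ θ, z (s₀, θ) = ζ θ := by
    intro θ
    simp only [hzdef, hY, ← hζ.lift θ, lineProj_hopf (hζ.norm θ), hζ.norm θ, inv_one, one_smul]
  have hzc : ∀ s, z (s, 1) = z (s, 0) := by
    intro s
    simp only [hzdef, hY, hcl, hζ.closed]
  have hmemU : ∀ s ∈ Icc s₀ s₁, ∀ θ, (s, θ) ∈ U := by
    intro s hs θ
    simp only [hUdef, mem_ofPred_eq, abs_lt]
    constructor <;> linarith [hs.1, hs.2]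
  have dz : ∀ p ∈ U, HasFDerivAt z (fderiv ℝ z p) p := fun p hp =>
    ((hz.contDiffAt (hU.mem_nhds hp)).differentiableAt (by simp)).hasFDerivAt
  have dθ : ∀ s ∈ Icc s₀ s₁, ∀ θ, deriv (fun θ => z (s, θ)) θ = fderiv ℝ z (s, θ) (0, 1) := by
    intro s hs θ
    exact ((dz _ (hmemU s hs θ)).comp_hasDerivAt θ
      ((hasDerivAt_const θ s).prodMk (hasDerivAt_id θ))).deriv
  have ds : ∀ s ∈ Icc s₀ s₁, ∀ θ, deriv (fun s => z (s, θ)) s = fderiv ℝ z (s, θ) (1, 0) := by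
    intro s hs θ
    exact ((dz _ (hmemU s hs θ)).comp_hasDerivAt s
      ((hasDerivAt_id s).prodMk (hasDerivAt_const s θ))).deriv
  have hst := sympl_stokes hU hz h01 fun p hp => hmemU p.1 hp.1 p.2
  -- The lift closes up for every `s`, so the contributions of the sides $\theta=0$ and $\theta=1$
  -- cancel.
  have e1 : ∫ s in s₀..s₁, sympl (z (s, 1)) (fderiv ℝ z (s, 1) (1, 0)) =
      ∫ s in s₀..s₁, sympl (z (s, 0)) (fderiv ℝ z (s, 0) (1, 0)) := by
    refine intervalIntegral.integral_congr fun s hs => ?_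
    rw [uIcc_of_le h01] at hs
    simp only [← ds s hs, hzc]
  have e2 : ∫ s in s₀..s₁, ∫ θ in (0 : ℝ)..1,
      2 * sympl (fderiv ℝ z (s, θ) (1, 0)) (fderiv ℝ z (s, θ) (0, 1)) =
      2 * ∫ s in s₀..s₁, ∫ θ in (0 : ℝ)..1, density W (s, θ) := by
    simp only [← intervalIntegral.integral_const_mul]
    refine intervalIntegral.integral_congr fun s hs => intervalIntegral.integral_congr fun θ _ => ?_
    rw [uIcc_of_le h01] at hs
    simp only [density_eq_sympl hU hz hn hl (hmemU s hs θ)]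
  have m0 : s₀ ∈ Icc s₀ s₁ := ⟨le_rfl, h01⟩
  have m1 : s₁ ∈ Icc s₀ s₁ := ⟨h01, le_rfl⟩
  refine ⟨fun θ => z (s₁, θ), ⟨?_, fun θ => hn _ (hmemU _ m1 θ), fun θ => hl _ (hmemU _ m1 θ), hzc s₁⟩,
    ?_⟩
  · rw [contDiff_iff_contDiffAt]
    intro θ
    exact (hz.contDiffAt (hU.mem_nhds (hmemU _ m1 θ))).comp θ
      (contDiffAt_const.prodMk contDiffAt_id)
  · rw [← e2, hst, e1]
    simp only [← dθ _ m0, ← dθ _ m1, hz0]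
    ring

/-- Radial induction in steps of length $1/N<\varepsilon$, starting from the constant lift of the
centre, whose action is zero. -/
theorem exists_isHopfLift {W : ℝ × ℝ → V3} (hW : ContDiff ℝ ∞ W) (hmem : ∀ p, W p ∈ CP1)
    (hcl : ∀ s, W (s, 1) = W (s, 0)) (hcentre : ∀ θ, W (0, θ) = W (0, 0)) {ε : ℝ} (hε : 0 < ε)
    (hnear : ∀ s s', |s - s'| < ε → ∀ θ, ‖W (s, θ) - W (s', θ)‖ < 1) :
    ∃ ζ, IsHopfLift (fun θ => W (1, θ)) ζ ∧
      2 * (∫ s in (0 : ℝ)..1, ∫ θ in (0 : ℝ)..1, density W (s, θ)) =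
        ∫ θ in (0 : ℝ)..1, sympl (ζ θ) (deriv ζ θ) := by
  have hcont' : Continuous fun s => ∫ θ in (0 : ℝ)..1, density W (s, θ) :=
    continuous_integral_density hW
  obtain ⟨N, hN⟩ := exists_nat_gt (1 / ε)
  have hN0 : (0 : ℝ) < N := lt_trans (by positivity) hN
  have step : ∀ k : ℕ, ∃ ζ, IsHopfLift (fun θ => W (k / N, θ)) ζ ∧
      2 * (∫ s in (0 : ℝ)..(k / N), ∫ θ in (0 : ℝ)..1, density W (s, θ)) =
        ∫ θ in (0 : ℝ)..1, sympl (ζ θ) (deriv ζ θ) := by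
    intro k
    induction k with
    | zero =>
      obtain ⟨z, hz, hzW⟩ : W (0, 0) ∈ hopf '' {z | ‖z‖ = 1} := hopf_image ▸ hmem _
      refine ⟨fun _ => z, ⟨contDiff_const, fun _ => hz, fun θ => ?_, rfl⟩, ?_⟩
      · simp [hzW, hcentre θ]
      · simp
    | succ k ih =>
      obtain ⟨ζ, hζ, hi⟩ := ih
      have hlt : ((k + 1 : ℕ) : ℝ) / N < k / N + ε := by
        have : 1 / N < ε := by
          rw [div_lt_iff₀ hε] at hN
          rw [div_lt_iff₀ hN0]
          linarith
        push_cast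
        rw [add_div]
        linarith
      have hle : (k : ℝ) / N ≤ ((k + 1 : ℕ) : ℝ) / N := by
        push_cast
        gcongr
        linarith
      obtain ⟨ζ', hζ', hi'⟩ := hζ.continue hW hmem hcl hle hlt (fun s hs => hnear s _ hs)
      refine ⟨ζ', hζ', ?_⟩
      rw [← intervalIntegral.integral_add_adjacent_intervals (hcont'.intervalIntegrable 0 (k / N))
        (hcont'.intervalIntegrable _ _), mul_add, hi, hi']
      ring
  have := step N
  rwa [div_self hN0.ne'] at this

theorem hasDerivAt_coord {ι : Type*} [Fintype ι] {c : ℝ → EuclideanSpace ℝ ι} {c' : EuclideanSpace ℝ ι}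
    {t : ℝ} (h : HasDerivAt c c' t) (i : ι) : HasDerivAt (fun t => c t i) (c' i) t :=
  (EuclideanSpace.proj i : EuclideanSpace ℝ ι →L[ℝ] ℝ).hasFDerivAt.comp_hasDerivAt t h

/-- The angular area swept by a plane curve, given by the first two coordinates of `c`. -/
noncomputable def swept (c : ℝ → V3) (θ : ℝ) : ℝ :=
  c θ 0 * deriv (fun t => c t 1) θ - c θ 1 * deriv (fun t => c t 0) θ

/-- Over the equator $|z_0|^2=|z_1|^2=1/2$, and the argument of $c$ is $\arg z_1-\arg z_0$. So the
action differs from twice the swept area by twice the area swept by the closed curve $z_0$, and the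
latter area is a multiple of $\pi$. -/
theorem IsHopfLift.action_equator {c : ℝ → V3} {ζ : ℝ → V4} (h : IsHopfLift c ζ)
    (hc : ∀ θ, c θ 2 = 0) :
    ∃ n : ℤ, ∫ θ in (0 : ℝ)..1, sympl (ζ θ) (deriv ζ θ) =
      2 * ((∫ θ in (0 : ℝ)..1, swept c θ) + n * Real.pi) := by
  have hs : ∀ i, ContDiff ℝ ∞ fun t => ζ t i := fun i => contDiff_euclidean.1 h.smooth i
  have hd : ∀ i t, HasDerivAt (fun t => ζ t i) (deriv (fun t => ζ t i) t) t := fun i t =>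
    ((hs i).differentiable (by simp) t).hasDerivAt
  have hderiv : ∀ i t, deriv ζ t i = deriv (fun t => ζ t i) t := by
    intro i t
    exact (hasDerivAt_coord (h.smooth.differentiable (by simp) t).hasDerivAt i).deriv.symm
  have e0 : ∀ θ, ζ θ 0 ^ 2 + ζ θ 1 ^ 2 = 1 / 2 := by
    intro θ
    have h1 := norm_V4_one.1 (h.norm θ)
    have h2 : hopf (ζ θ) 2 = 0 := by rw [h.lift, hc]
    simp only [hopf, Matrix.cons_val] at h2
    linarith
  have e1 : ∀ θ, ζ θ 2 ^ 2 + ζ θ 3 ^ 2 = 1 / 2 := by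
    intro θ
    have h1 := norm_V4_one.1 (h.norm θ)
    linarith [e0 θ]
  obtain ⟨m, hm⟩ := exists_winding (by norm_num) (hs 0) (hs 1) (fun t _ => e0 t)
    (by rw [h.closed]) (by rw [h.closed])
  have c0 : (fun t => c t 0) = fun t => ζ t 0 * ζ t 2 + ζ t 1 * ζ t 3 := by
    funext t
    rw [← h.lift t]
    simp [hopf]
  have c1 : (fun t => c t 1) = fun t => ζ t 0 * ζ t 3 - ζ t 1 * ζ t 2 := by
    funext t
    rw [← h.lift t]
    simp [hopf]
  have hsw : ∀ t, sympl (ζ t) (deriv ζ t) = 2 * swept c t +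
      2 * (ζ t 0 * deriv (fun t => ζ t 1) t - ζ t 1 * deriv (fun t => ζ t 0) t) := by
    intro t
    have d0 := ((hd 0 t).mul (hd 2 t)).add ((hd 1 t).mul (hd 3 t))
    have d1 := ((hd 0 t).mul (hd 3 t)).sub ((hd 1 t).mul (hd 2 t))
    have d0' := (d0.congr_of_eventuallyEq (.of_forall (congrFun c0))).deriv
    have d1' := (d1.congr_of_eventuallyEq (.of_forall (congrFun c1))).deriv
    rw [swept, d0', d1', congrFun c0 t, congrFun c1 t, sympl_apply]
    simp only [hderiv]
    linear_combination (-2 * (ζ t 2 * deriv (fun t => ζ t 3) t - ζ t 3 * deriv (fun t => ζ t 2) t)) * e0 t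
      + 2 * (ζ t 0 * deriv (fun t => ζ t 1) t - ζ t 1 * deriv (fun t => ζ t 0) t) * e1 t
  have hcc : ∀ i j, Continuous fun t => ζ t i * deriv (fun t => ζ t j) t := fun i j =>
    (hs i).continuous.mul ((hs j).continuous_deriv (by simp))
  have hcsw : Continuous (swept c) := by
    have hcs : ∀ i, ContDiff ℝ ∞ fun t => c t i := by
      intro i
      have : c = fun t => hopf (ζ t) := by funext t; rw [h.lift]
      rw [this]
      exact contDiff_euclidean.1 (contDiff_hopf.comp h.smooth) i
    exact ((hcs 0).continuous.mul ((hcs 1).continuous_deriv (by simp))).sub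
      ((hcs 1).continuous.mul ((hcs 0).continuous_deriv (by simp)))
  have hcz : Continuous fun t => 2 * (ζ t 0 * deriv (fun t => ζ t 1) t
      - ζ t 1 * deriv (fun t => ζ t 0) t) := ((hcc 0 1).sub (hcc 1 0)).const_mul 2
  refine ⟨m, ?_⟩
  simp only [hsw]
  rw [intervalIntegral.integral_add ((hcsw.const_mul 2).intervalIntegrable _ _)
    (hcz.intervalIntegrable _ _),
    intervalIntegral.integral_const_mul, intervalIntegral.integral_const_mul, hm]
  ring

/-- A smooth surjection of the line to the unit interval. -/
noncomputable def fold (t : ℝ) : ℝ := (1 - Real.cos (Real.pi * t)) / 2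

theorem fold_mem (t : ℝ) : fold t ∈ Icc (0 : ℝ) 1 := by
  constructor <;> unfold fold <;> linarith [Real.neg_one_le_cos (Real.pi * t), Real.cos_le_one (Real.pi * t)]

theorem fold_zero : fold 0 = 0 := by simp [fold]

theorem fold_one : fold 1 = 1 := by simp [fold]

theorem contDiff_fold : ContDiff ℝ ∞ fold := by unfold fold; fun_prop

theorem hasDerivAt_fold (t : ℝ) : HasDerivAt fold (deriv fold t) t :=
  (contDiff_fold.differentiable (by simp) t).hasDerivAt

theorem abs_fold_sub_le (s t : ℝ) : |fold s - fold t| ≤ 2 * |s - t| := by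
  have h : fold s - fold t = (Real.cos (Real.pi * t) - Real.cos (Real.pi * s)) / 2 := by
    unfold fold; ring
  have h1 := Real.abs_cos_sub_cos_le (Real.pi * t) (Real.pi * s)
  rw [← mul_sub, abs_mul, abs_of_pos Real.pi_pos, abs_sub_comm t s] at h1
  rw [h, abs_div, abs_two]
  nlinarith [Real.pi_le_four, abs_nonneg (s - t)]

theorem integral_fold {g : ℝ → ℝ} (hg : Continuous g) :
    ∫ t in (0 : ℝ)..1, g (fold t) * deriv fold t = ∫ t in (0 : ℝ)..1, g t := by
  have h := intervalIntegral.integral_comp_mul_deriv (a := 0) (b := 1) (fun t _ => hasDerivAt_fold t)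
    (contDiff_fold.continuous_deriv (by simp)).continuousOn hg
  rwa [fold_zero, fold_one] at h

theorem continuous_swept {c : ℝ → V3} (hc : ContDiff ℝ ∞ c) : Continuous (swept c) := by
  have hcs : ∀ i, ContDiff ℝ ∞ fun t => c t i := contDiff_euclidean.1 hc
  exact ((hcs 0).continuous.mul ((hcs 1).continuous_deriv (by simp))).sub
    ((hcs 1).continuous.mul ((hcs 0).continuous_deriv (by simp)))

/-- The area of a disc in `ℂP¹` with boundary on the equator, modulo `π`. -/
theorem exists_area_eq_swept {v : ℝ × ℝ → V3} (hv : ContDiff ℝ ∞ v)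
    (hmem : ∀ s ∈ Icc (0 : ℝ) 1, ∀ θ ∈ Icc (0 : ℝ) 1, v (s, θ) ∈ CP1)
    (hcentre : ∀ θ ∈ Icc (0 : ℝ) 1, v (0, θ) = v (0, 0))
    (hcl : ∀ s ∈ Icc (0 : ℝ) 1, v (s, 0) = v (s, 1))
    (hbd : ∀ θ ∈ Icc (0 : ℝ) 1, v (1, θ) 2 = 0) :
    ∃ n : ℤ, ∫ s in (0 : ℝ)..1, ∫ θ in (0 : ℝ)..1, density v (s, θ) =
      (∫ θ in (0 : ℝ)..1, swept (fun θ => v (1, θ)) θ) + n * Real.pi := by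
  -- The conditions on the disc hold only on the unit square. Precomposing with `fold` makes them
  -- global; since `fold` fixes $0$ and $1$, substitution shows that no integral changes.
  set W : ℝ × ℝ → V3 := fun p => v (fold p.1, fold p.2) with hWdef
  have hW : ContDiff ℝ ∞ W := hv.comp ((contDiff_fold.comp contDiff_fst).prodMk
    (contDiff_fold.comp contDiff_snd))
  have dv : ∀ p, HasFDerivAt v (fderiv ℝ v p) p := fun p => (hv.differentiable (by simp) p).hasFDerivAt
  obtain ⟨δ, hδ, hδv⟩ := Metric.uniformContinuousOn_iff.1
    ((isCompact_Icc.prod isCompact_Icc).uniformContinuousOn_of_continuous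
      (hv.continuous.continuousOn (s := Icc (0 : ℝ) 1 ×ˢ Icc (0 : ℝ) 1))) 1 one_pos
  -- Half of `δ` suffices because `fold` is 2-Lipschitz.
  obtain ⟨ζ, hζ, hi⟩ := exists_isHopfLift hW (fun p => hmem _ (fold_mem _) _ (fold_mem _))
    (fun s => by simp only [hWdef, fold_zero, fold_one]; exact (hcl _ (fold_mem s)).symm)
    (fun θ => by simp only [hWdef, fold_zero]; exact hcentre _ (fold_mem θ)) (half_pos hδ)
    (fun s s' hs θ => by
      rw [← dist_eq_norm]
      refine hδv _ ⟨fold_mem _, fold_mem _⟩ _ ⟨fold_mem _, fold_mem _⟩ ?_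
      rw [Prod.dist_eq, dist_self, max_eq_left dist_nonneg, Real.dist_eq]
      linarith [abs_fold_sub_le s s'])
  obtain ⟨n, hn⟩ := hζ.action_equator fun θ => by
    simp only [hWdef, fold_one]
    exact hbd _ (fold_mem θ)
  have dW : ∀ s θ, fderiv ℝ W (s, θ) (1, 0) = deriv fold s • fderiv ℝ v (fold s, fold θ) (1, 0) ∧
      fderiv ℝ W (s, θ) (0, 1) = deriv fold θ • fderiv ℝ v (fold s, fold θ) (0, 1) := by
    intro s θ
    have h1 : HasFDerivAt (fun p : ℝ × ℝ => fold p.1) (deriv fold s • ContinuousLinearMap.fst ℝ ℝ ℝ)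
        (s, θ) := HasDerivAt.comp_hasFDerivAt (f := Prod.fst) (s, θ) (hasDerivAt_fold s) hasFDerivAt_fst
    have h2 : HasFDerivAt (fun p : ℝ × ℝ => fold p.2) (deriv fold θ • ContinuousLinearMap.snd ℝ ℝ ℝ)
        (s, θ) := HasDerivAt.comp_hasFDerivAt (f := Prod.snd) (s, θ) (hasDerivAt_fold θ) hasFDerivAt_snd
    have h : HasFDerivAt W _ (s, θ) := (dv (fold s, fold θ)).comp (s, θ) (h1.prodMk h2)
    rw [h.fderiv]
    constructor <;> simp [← map_smul]
  have hdens : ∀ s θ, density W (s, θ) = density v (fold s, fold θ) * deriv fold θ * deriv fold s := by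
    intro s θ
    rw [density, density, (dW s θ).1, (dW s θ).2]
    simp only [omegaFS, PiLp.smul_apply, smul_eq_mul, hWdef]
    ring
  have hcont := continuous_density hv
  have hcont' : Continuous fun s => ∫ θ in (0 : ℝ)..1, density v (s, θ) :=
    continuous_integral_density hv
  have a1 : ∫ s in (0 : ℝ)..1, ∫ θ in (0 : ℝ)..1, density W (s, θ) =
      ∫ s in (0 : ℝ)..1, ∫ θ in (0 : ℝ)..1, density v (s, θ) := by
    rw [← integral_fold hcont']
    refine intervalIntegral.integral_congr fun s _ => ?_
    simp only [hdens, intervalIntegral.integral_mul_const]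
    rw [integral_fold (g := fun θ => density v (fold s, θ)) (by fun_prop)]
  have hc : ContDiff ℝ ∞ fun θ => v (1, θ) := hv.comp (contDiff_const.prodMk contDiff_id)
  have a2 : ∫ θ in (0 : ℝ)..1, swept (fun θ => W (1, θ)) θ =
      ∫ θ in (0 : ℝ)..1, swept (fun θ => v (1, θ)) θ := by
    rw [← integral_fold (continuous_swept hc)]
    refine intervalIntegral.integral_congr fun θ _ => ?_
    have hd : ∀ i, deriv (fun t => W (1, t) i) θ =
        deriv (fun t => v (1, t) i) (fold θ) * deriv fold θ := by
      intro i
      have h1 := ((contDiff_euclidean.1 hc i).differentiable (by simp) (fold θ)).hasDerivAt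
      simp only [hWdef, fold_one]
      exact (h1.comp θ (hasDerivAt_fold θ)).deriv
    simp only [swept, hd]
    simp only [hWdef, fold_one]
    ring
  exact ⟨n, by linarith⟩

/-- At the endpoints the derivatives may differ, so the integrals are compared over the open
interval. -/
theorem integral_swept_congr {c d : ℝ → V3} (h : ∀ θ ∈ Icc (0 : ℝ) 1, c θ = d θ) :
    ∫ θ in (0 : ℝ)..1, swept c θ = ∫ θ in (0 : ℝ)..1, swept d θ := by
  rw [intervalIntegral.integral_of_le zero_le_one, intervalIntegral.integral_of_le zero_le_one,
    MeasureTheory.integral_Ioc_eq_integral_Ioo, MeasureTheory.integral_Ioc_eq_integral_Ioo]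
  refine MeasureTheory.setIntegral_congr_fun measurableSet_Ioo fun θ hθ => ?_
  have hd : ∀ i, deriv (fun t => c t i) θ = deriv (fun t => d t i) θ := by
    intro i
    refine Filter.EventuallyEq.deriv_eq ?_
    filter_upwards [Icc_mem_nhds hθ.1 hθ.2] with t ht
    rw [h t ht]
  simp only [swept, hd, h θ (Ioo_subset_Icc_self hθ)]

/-- The area of a disc with boundary on the product torus is determined modulo `π` by its boundary. -/
theorem IsDisc.exists_area_eq {u : ℝ × ℝ → V3 × V3} (hu : IsDisc u) {c : ℝ → V3 × V3}
    (hc : ∀ θ ∈ Icc (0 : ℝ) 1, c θ ∈ productTorus) (hb : ∀ θ ∈ Icc (0 : ℝ) 1, u (1, θ) = c θ) :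
    ∃ n : ℤ, area u = (∫ θ in (0 : ℝ)..1, swept (fun t => (c t).1) θ)
      + (∫ θ in (0 : ℝ)..1, swept (fun t => (c t).2) θ) + n * Real.pi := by
  have h1 : ContDiff ℝ ∞ fun p => (u p).1 := contDiff_fst.comp hu.smooth
  have h2 : ContDiff ℝ ∞ fun p => (u p).2 := contDiff_snd.comp hu.smooth
  have du : ∀ p, HasFDerivAt u (fderiv ℝ u p) p := fun p =>
    (hu.smooth.differentiable (by simp) p).hasFDerivAt
  have d1 : ∀ p, fderiv ℝ (fun p => (u p).1) p = _ := fun p => (du p).fst.fderiv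
  have d2 : ∀ p, fderiv ℝ (fun p => (u p).2) p = _ := fun p => (du p).snd.fderiv
  obtain ⟨n, hn⟩ := exists_area_eq_swept h1 (fun s hs θ hθ => (hu.mem s hs θ hθ).1)
    (fun θ hθ => by rw [hu.centre θ hθ]) (fun s hs => by rw [hu.closes s hs])
    (fun θ hθ => by rw [hb θ hθ]; exact (hc θ hθ).2.1)
  obtain ⟨m, hm⟩ := exists_area_eq_swept h2 (fun s hs θ hθ => (hu.mem s hs θ hθ).2)
    (fun θ hθ => by rw [hu.centre θ hθ]) (fun s hs => by rw [hu.closes s hs])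
    (fun θ hθ => by rw [hb θ hθ]; exact (hc θ hθ).2.2)
  rw [integral_swept_congr (d := fun t => (c t).1) fun θ hθ => by rw [hb θ hθ]] at hn
  rw [integral_swept_congr (d := fun t => (c t).2) fun θ hθ => by rw [hb θ hθ]] at hm
  have c1 := continuous_density h1
  have c2 := continuous_density h2
  have ha : area u = (∫ s in (0 : ℝ)..1, ∫ θ in (0 : ℝ)..1, density (fun p => (u p).1) (s, θ))
      + ∫ s in (0 : ℝ)..1, ∫ θ in (0 : ℝ)..1, density (fun p => (u p).2) (s, θ) := by
    rw [← intervalIntegral.integral_add]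
    · refine intervalIntegral.integral_congr fun s _ => ?_
      rw [← intervalIntegral.integral_add]
      · refine intervalIntegral.integral_congr fun θ _ => ?_
        simp only [density, omega, d1, d2]
        rfl
      · exact Continuous.intervalIntegrable (by fun_prop) _ _
      · exact Continuous.intervalIntegrable (by fun_prop) _ _
    · exact (continuous_integral_density h1).intervalIntegrable _ _
    · exact (continuous_integral_density h2).intervalIntegrable _ _
  refine ⟨n + m, ?_⟩
  rw [ha, hn, hm]
  push_cast
  ring

/-- The cone over a curve on the equator, with apex the north pole. -/
noncomputable def cone (c : ℝ → V3) (p : ℝ × ℝ) : V3 :=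
  Real.sin (Real.pi / 2 * p.1) • c p.2 + Real.cos (Real.pi / 2 * p.1) • !₂[0, 0, 1 / 2]

theorem cone_mem {c : ℝ → V3} {p : ℝ × ℝ} (hc : c p.2 ∈ CP1) (h2 : c p.2 2 = 0) : cone c p ∈ CP1 := by
  rw [mem_CP1] at hc ⊢
  rw [h2] at hc
  simp [cone, h2]
  linear_combination Real.sin (Real.pi / 2 * p.1) ^ 2 * hc
    + 1 / 4 * Real.sin_sq_add_cos_sq (Real.pi / 2 * p.1)

theorem contDiff_cone {c : ℝ → V3} (hc : ContDiff ℝ ∞ c) : ContDiff ℝ ∞ (cone c) := by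
  unfold cone
  fun_prop

/-- A smooth loop in the product torus bounds a disc. -/
theorem exists_disc {c : ℝ → V3 × V3} (hs : ContDiff ℝ ∞ c) (hc : ∀ θ, c θ ∈ productTorus)
    (h01 : c 0 = c 1) : ∃ u, IsDisc u ∧ ∀ θ, u (1, θ) = c θ := by
  refine ⟨fun p => (cone (fun t => (c t).1) p, cone (fun t => (c t).2) p), ⟨?_, ?_, ?_, ?_⟩, ?_⟩
  · exact (contDiff_cone (contDiff_fst.comp hs)).prodMk (contDiff_cone (contDiff_snd.comp hs))
  · intro s _ θ _
    exact ⟨cone_mem (c := fun t => (c t).1) (p := (s, θ)) (hc θ).1.1 (hc θ).2.1,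
      cone_mem (c := fun t => (c t).2) (p := (s, θ)) (hc θ).1.2 (hc θ).2.2⟩
  · intro θ _
    simp [cone]
  · intro s _
    simp [cone, h01]
  · intro θ
    simp [cone]

theorem exists_integral_swept {c : ℝ → V3} (hs : ContDiff ℝ ∞ c)
    (hc : ∀ θ ∈ Icc (0 : ℝ) 1, c θ ∈ CP1) (h2 : ∀ θ ∈ Icc (0 : ℝ) 1, c θ 2 = 0) (h01 : c 1 = c 0) :
    ∃ n : ℤ, ∫ θ in (0 : ℝ)..1, swept c θ = n * (Real.pi / 2) := by
  obtain ⟨n, hn⟩ := exists_winding (r := 1 / 4) (by norm_num) (contDiff_euclidean.1 hs 0)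
    (contDiff_euclidean.1 hs 1) (fun t ht => by
      have := mem_CP1.1 (hc t ht)
      rw [h2 t ht] at this
      linarith) (by rw [h01]) (by rw [h01])
  refine ⟨n, ?_⟩
  unfold swept
  rw [hn]
  ring

/-- Each component of the boundary sweeps a multiple of $\pi/2$, since the equator has radius $1/2$,
and the boundary determines the area modulo $\pi$. -/
theorem actionIn_two : ActionIn productTorus 2 := by
  intro u hu hb
  obtain ⟨n, hn⟩ := hu.exists_area_eq hb fun θ _ => rfl
  have hs : ContDiff ℝ ∞ fun θ => u (1, θ) := hu.smooth.comp (contDiff_const.prodMk contDiff_id)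
  have hcl : u (1, 1) = u (1, 0) := (hu.closes 1 ⟨zero_le_one, le_rfl⟩).symm
  obtain ⟨k, hk⟩ := exists_integral_swept (contDiff_fst.comp hs) (fun θ hθ => (hb θ hθ).1.1)
    (fun θ hθ => (hb θ hθ).2.1) (by simp [hcl])
  obtain ⟨l, hl⟩ := exists_integral_swept (contDiff_snd.comp hs) (fun θ hθ => (hb θ hθ).1.2)
    (fun θ hθ => (hb θ hθ).2.2) (by simp [hcl])
  refine ⟨k + l + 2 * n, ?_⟩
  simp only [Function.comp_def] at hk hl
  rw [hn, hk, hl]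
  push_cast
  ring

theorem not_actionIn_one : ¬ ActionIn productTorus 1 := by
  intro h
  -- Once around the first equator and constant in the second factor: the loop bounds a hemisphere,
  -- of area $\pi/2$ modulo $\pi$.
  set c : ℝ → V3 × V3 := fun θ =>
    (!₂[Real.cos (2 * Real.pi * θ) / 2, Real.sin (2 * Real.pi * θ) / 2, 0], !₂[1 / 2, 0, 0]) with hcdef
  have hs : ContDiff ℝ ∞ c := by
    refine ContDiff.prodMk ?_ contDiff_const
    rw [contDiff_euclidean]
    intro i
    fin_cases i <;> simp <;> fun_prop
  have hc : ∀ θ, c θ ∈ productTorus := by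
    intro θ
    simp only [productTorus, M, mem_ofPred_eq, mem_CP1, hcdef, Matrix.cons_val]
    refine ⟨⟨?_, by norm_num⟩, trivial, trivial⟩
    linear_combination 1 / 4 * Real.cos_sq_add_sin_sq (2 * Real.pi * θ)
  obtain ⟨u, hu, hb⟩ := exists_disc hs hc (by simp [hcdef])
  obtain ⟨n, hn⟩ := hu.exists_area_eq (fun θ _ => hc θ) (fun θ _ => hb θ)
  obtain ⟨m, hm⟩ := h u hu fun θ _ => hb θ ▸ hc θ
  have s1 : ∀ θ, swept (fun t => (c t).1) θ = Real.pi / 2 := by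
    intro θ
    have hl : HasDerivAt (fun t : ℝ => 2 * Real.pi * t) (2 * Real.pi) θ := by
      simpa using (hasDerivAt_id θ).const_mul (2 * Real.pi)
    have h1 := (((Real.hasDerivAt_cos _).comp θ hl).div_const 2).deriv
    have h2 := (((Real.hasDerivAt_sin _).comp θ hl).div_const 2).deriv
    simp only [Function.comp_def] at h1 h2
    simp only [swept, hcdef, Matrix.cons_val, h1, h2]
    linear_combination Real.pi / 2 * Real.cos_sq_add_sin_sq (2 * Real.pi * θ)
  have s2 : ∀ θ, swept (fun t => (c t).2) θ = 0 := by
    intro θ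
    simp [swept, hcdef]
  simp only [s1, s2] at hn
  simp at hn hm
  have h3 : (1 + 2 * (n : ℝ) - 2 * m) * Real.pi = 0 := by linarith
  rcases mul_eq_zero.1 h3 with h4 | h4
  · have : (1 + 2 * n - 2 * m : ℤ) = 0 := by exact_mod_cast h4
    omega
  · exact Real.pi_ne_zero h4

theorem isLeast_actionIn : IsLeast {j : ℕ | 1 ≤ j ∧ ActionIn productTorus j} 2 := by
  refine ⟨⟨one_le_two, actionIn_two⟩, fun j hj => ?_⟩
  by_contra hlt
  obtain rfl : j = 1 := by have := hj.1; omega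
  exact not_actionIn_one hj.2

/-! ### The conormal torus of the great circle -/

/-- The conormal lift of the great circle. -/
noncomputable def greatTorus (x : ℝ × ℝ) : V4 × V4 :=
  (!₂[Real.cos (2 * Real.pi * x.1) / 2, Real.sin (2 * Real.pi * x.1) / 2, 0, 0],
    !₂[0, 0, Real.cos (2 * Real.pi * x.2), Real.sin (2 * Real.pi * x.2)])

theorem greatTorus_mem (x : ℝ × ℝ) : greatTorus x ∈ UTS3 := by
  rw [mem_UTS3]
  simp only [inner_V4, greatTorus, Matrix.cons_val]
  refine ⟨?_, by ring, ?_⟩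
  · linear_combination 1 / 4 * Real.cos_sq_add_sin_sq (2 * Real.pi * x.1)
  · linear_combination Real.cos_sq_add_sin_sq (2 * Real.pi * x.2)

theorem range_greatTorus : range greatTorus =
    {e | e ∈ UTS3 ∧ (e.1 2 = 0 ∧ e.1 3 = 0) ∧ e.2 0 = 0 ∧ e.2 1 = 0} := by
  ext e
  constructor
  · rintro ⟨x, rfl⟩
    exact ⟨greatTorus_mem x, ⟨rfl, rfl⟩, rfl, rfl⟩
  · rintro ⟨he, ⟨h2, h3⟩, h0, h1⟩
    obtain ⟨qq, -, pp⟩ := mem_UTS3.1 he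
    rw [inner_V4, h2, h3] at qq
    rw [inner_V4, h0, h1] at pp
    obtain ⟨a, hc, hs⟩ := exists_cos_sin (a := 2 * e.1 0) (b := 2 * e.1 1) (by linarith)
    obtain ⟨b, hc', hs'⟩ := exists_cos_sin (a := e.2 2) (b := e.2 3) (by linarith)
    refine ⟨(a / (2 * Real.pi), b / (2 * Real.pi)), ?_⟩
    have ha : 2 * Real.pi * (a / (2 * Real.pi)) = a := by field_simp
    have hb : 2 * Real.pi * (b / (2 * Real.pi)) = b := by field_simp
    ext i <;> fin_cases i <;> simp [greatTorus, ha, hb, hc, hs, hc', hs', h0, h1, h2, h3]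

theorem isTorusMap_greatTorus : IsTorusMap greatTorus := by
  constructor
  · refine ContDiff.prodMk ?_ ?_ <;>
    · rw [contDiff_euclidean]
      intro i
      fin_cases i <;> simp <;> fun_prop
  · intro x m n
    have h : ∀ (t : ℝ) (k : ℤ), 2 * Real.pi * (t + k) = 2 * Real.pi * t + k * (2 * Real.pi) := by
      intros; ring
    simp only [greatTorus, Prod.fst_add, Prod.snd_add, h, Real.cos_add_int_mul_two_pi,
      Real.sin_add_int_mul_two_pi]

theorem proj_greatTorus (x : ℝ × ℝ) : proj (greatTorus x) =
    (!₂[Real.sin (2 * Real.pi * (x.1 + x.2)) / 2, Real.cos (2 * Real.pi * (x.1 + x.2)) / 2, 0],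
      !₂[Real.sin (2 * Real.pi * (x.2 - x.1)) / 2, -Real.cos (2 * Real.pi * (x.2 - x.1)) / 2, 0]) := by
  simp only [mul_add, mul_sub, Real.sin_add, Real.cos_add, Real.sin_sub, Real.cos_sub]
  ext i <;> fin_cases i <;> simp [proj, pluecker, greatTorus] <;> ring

theorem cos_sin_eq_iff {s t : ℝ} :
    (Real.cos (2 * Real.pi * s) = Real.cos (2 * Real.pi * t) ∧
      Real.sin (2 * Real.pi * s) = Real.sin (2 * Real.pi * t)) ↔ ∃ k : ℤ, t - s = k := by
  constructor
  · rintro ⟨hc, hs⟩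
    obtain ⟨k, hk⟩ := Real.Angle.angle_eq_iff_two_pi_dvd_sub.1 (Real.Angle.cos_sin_inj hc hs)
    refine ⟨-k, ?_⟩
    have : 2 * Real.pi * (s - t - k) = 0 := by linarith
    rcases mul_eq_zero.1 this with h | h
    · exact absurd h Real.two_pi_pos.ne'
    · push_cast
      linarith
  · rintro ⟨k, hk⟩
    have : 2 * Real.pi * t = 2 * Real.pi * s + k * (2 * Real.pi) := by rw [← hk]; ring
    rw [this, Real.cos_add_int_mul_two_pi, Real.sin_add_int_mul_two_pi]
    exact ⟨rfl, rfl⟩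

/-- The angles downstairs are the sum and the difference of those upstairs. Both change by integers
on a lattice that contains $\mathbb{Z}^2$ with index two; the other coset is that of $(1/2,1/2)$. -/
theorem proj_greatTorus_eq_iff {x y : ℝ × ℝ} : proj (greatTorus x) = proj (greatTorus y) ↔
    (∃ m n : ℤ, y - x = ((m : ℝ), (n : ℝ))) ∨ ∃ m n : ℤ, y - x = ((m : ℝ) + 1 / 2, (n : ℝ) + 1 / 2) := by
  have h : proj (greatTorus x) = proj (greatTorus y) ↔
      (∃ k : ℤ, y.1 + y.2 - (x.1 + x.2) = k) ∧ ∃ k : ℤ, y.2 - y.1 - (x.2 - x.1) = k := by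
    rw [← cos_sin_eq_iff, ← cos_sin_eq_iff, proj_greatTorus, proj_greatTorus]
    constructor
    · intro h
      rw [Prod.mk.injEq] at h
      obtain ⟨h1, h2⟩ := h
      have f := fun i => congrFun (congrArg WithLp.ofLp h1) i
      have g := fun i => congrFun (congrArg WithLp.ofLp h2) i
      have f0 := f 0; have f1 := f 1; have g0 := g 0; have g1 := g 1
      simp only [Matrix.cons_val] at f0 f1 g0 g1
      refine ⟨⟨?_, ?_⟩, ?_, ?_⟩ <;> linarith
    · rintro ⟨⟨h1, h2⟩, h3, h4⟩
      rw [h1, h2, h3, h4]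
  rw [h]
  constructor
  · rintro ⟨⟨k, hk⟩, l, hl⟩
    -- The difference `k - l` is twice the change of the first coordinate, so its parity selects the
    -- coset.
    rcases Int.even_or_odd' (k - l) with ⟨m, hm | hm⟩
    · left
      refine ⟨m, m + l, Prod.ext ?_ ?_⟩ <;>
      · have : (k : ℝ) - l = 2 * m := by exact_mod_cast hm
        push_cast [Prod.fst_sub, Prod.snd_sub]
        linarith
    · right
      refine ⟨m, m + l, Prod.ext ?_ ?_⟩ <;>
      · have : (k : ℝ) - l = 2 * m + 1 := by exact_mod_cast hm
        push_cast [Prod.fst_sub, Prod.snd_sub]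
        linarith
  · rintro (⟨m, n, hmn⟩ | ⟨m, n, hmn⟩)
    · have h1 := congrArg Prod.fst hmn
      have h2 := congrArg Prod.snd hmn
      simp only [Prod.fst_sub, Prod.snd_sub] at h1 h2
      exact ⟨⟨m + n, by push_cast; linarith⟩, n - m, by push_cast; linarith⟩
    · have h1 := congrArg Prod.fst hmn
      have h2 := congrArg Prod.snd hmn
      simp only [Prod.fst_sub, Prod.snd_sub] at h1 h2
      exact ⟨⟨m + n + 1, by push_cast; linarith⟩, n - m, by push_cast; linarith⟩

theorem greatTorus_eq_iff {x y : ℝ × ℝ} :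
    greatTorus x = greatTorus y ↔ ∃ m n : ℤ, y - x = ((m : ℝ), (n : ℝ)) := by
  constructor
  · intro h
    rw [greatTorus, greatTorus, Prod.mk.injEq] at h
    obtain ⟨h1, h2⟩ := h
    have f := fun i => congrFun (congrArg WithLp.ofLp h1) i
    have g := fun i => congrFun (congrArg WithLp.ofLp h2) i
    have f0 := f 0; have f1 := f 1; have g2 := g 2; have g3 := g 3
    simp only [Matrix.cons_val] at f0 f1 g2 g3
    obtain ⟨m, hm⟩ := (cos_sin_eq_iff (s := x.1) (t := y.1)).1 ⟨by linarith, by linarith⟩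
    obtain ⟨n, hn⟩ := (cos_sin_eq_iff (s := x.2) (t := y.2)).1 ⟨g2, g3⟩
    exact ⟨m, n, Prod.ext hm hn⟩
  · rintro ⟨m, n, hmn⟩
    rw [← isTorusMap_greatTorus.periodic x m n, ← hmn, add_sub_cancel]

theorem range_proj_greatTorus : range (fun x => proj (greatTorus x)) = productTorus := by
  ext y
  constructor
  · rintro ⟨x, rfl⟩
    refine ⟨proj_image ▸ mem_image_of_mem _ (greatTorus_mem x), ?_, ?_⟩ <;>
      simp [proj_greatTorus]
  · rintro ⟨⟨h1, h2⟩, h3, h4⟩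
    rw [mem_CP1] at h1 h2
    rw [h3] at h1
    rw [h4] at h2
    obtain ⟨s, hc, hs⟩ := exists_cos_sin (a := 2 * y.1 1) (b := 2 * y.1 0) (by linarith)
    obtain ⟨d, hc', hs'⟩ := exists_cos_sin (a := -(2 * y.2 1)) (b := 2 * y.2 0) (by linarith)
    -- Here $s$ and $d$ are $2\pi$ times the sum and the difference of the coordinates to be found.
    refine ⟨((s - d) / (4 * Real.pi), (s + d) / (4 * Real.pi)), ?_⟩
    have e1 : 2 * Real.pi * ((s - d) / (4 * Real.pi) + (s + d) / (4 * Real.pi)) = s := by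
      field_simp; ring
    have e2 : 2 * Real.pi * ((s + d) / (4 * Real.pi) - (s - d) / (4 * Real.pi)) = d := by
      field_simp; ring
    simp only [proj_greatTorus, e1, e2, hc, hs, hc', hs']
    ext i <;> fin_cases i <;> simp [h3, h4]

/-! ### Tangency, the Reeb flow on Legendrians, and areas over the model torus -/

theorem fderiv_fst_coord {E : Type*} [NormedAddCommGroup E] [NormedSpace ℝ E] {f : E → V4 × V4} {x : E}
    (h : DifferentiableAt ℝ f x) (i : Fin 4) (v : E) :
    (fderiv ℝ f x v).1 i = fderiv ℝ (fun y => (f y).1 i) x v := by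
  have := ((EuclideanSpace.proj i : V4 →L[ℝ] ℝ).comp (ContinuousLinearMap.fst ℝ V4 V4)).hasFDerivAt.comp
    x h.hasFDerivAt
  exact (congrArg (fun l : E →L[ℝ] ℝ => l v) this.fderiv).symm

/-- Velocity vectors of maps to `UT*S³` are tangent to it. -/
theorem fderiv_mem_tangentUTS3 {E : Type*} [NormedAddCommGroup E] [NormedSpace ℝ E] {f : E → V4 × V4}
    (hf : Differentiable ℝ f) (hm : ∀ x, f x ∈ UTS3) (x v : E) :
    fderiv ℝ f x v ∈ tangentUTS3 (f x) := by
  have h1 := (hf x).hasFDerivAt.fst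
  have h2 := (hf x).hasFDerivAt.snd
  have key : ∀ {g : E → ℝ} {g' : E →L[ℝ] ℝ} {r : ℝ}, HasFDerivAt g g' x → (∀ y, g y = r) →
      g' v = 0 := by
    intro g g' r hg hr
    have : g = fun _ => r := funext hr
    rw [this] at hg
    rw [hg.unique (hasFDerivAt_const r x)]
    rfl
  have k1 := key (h1.inner ℝ h1) fun y => (mem_UTS3.1 (hm y)).1
  have k2 := key (h1.inner ℝ h2) fun y => (mem_UTS3.1 (hm y)).2.1
  have k3 := key (h2.inner ℝ h2) fun y => (mem_UTS3.1 (hm y)).2.2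
  simp [fderivInnerCLM_apply] at k1 k2 k3
  refine ⟨?_, ?_, ?_⟩
  · rw [real_inner_comm (f x).1] at k1
    linarith
  · linarith
  · rw [real_inner_comm (f x).2] at k3
    linarith

/-- The time `t` map of the Reeb flow as a linear map. -/
noncomputable def reebFlowL (t : ℝ) : V4 × V4 →L[ℝ] V4 × V4 :=
  (Real.cos (2 * t) • ContinuousLinearMap.fst ℝ V4 V4
    + (Real.sin (2 * t) / 2) • ContinuousLinearMap.snd ℝ V4 V4).prod
  (-(2 * Real.sin (2 * t)) • ContinuousLinearMap.fst ℝ V4 V4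
    + Real.cos (2 * t) • ContinuousLinearMap.snd ℝ V4 V4)

theorem fderiv_reebFlow_comp {E : Type*} [NormedAddCommGroup E] [NormedSpace ℝ E] {f : E → V4 × V4} {x : E}
    (hf : DifferentiableAt ℝ f x) (t : ℝ) (v : E) :
    fderiv ℝ (fun y => reebFlow t (f y)) x v = reebFlow t (fderiv ℝ f x v) :=
  congrArg (fun l : E →L[ℝ] V4 × V4 => l v) ((reebFlowL t).hasFDerivAt.comp x hf.hasFDerivAt).fderiv

/-- The pairing expands to $\cos^2(2t)\langle p,v_1\rangle-\sin^2(2t)\langle q,v_2\rangle$, and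
tangency gives $\langle q,v_2\rangle=-\langle p,v_1\rangle$. -/
theorem alpha_reebFlow {e v : V4 × V4} (hv : v ∈ tangentUTS3 e) (t : ℝ) :
    alpha (reebFlow t e) (reebFlow t v) = alpha e v := by
  obtain ⟨h1, h2, h3⟩ := hv
  rw [real_inner_comm] at h2
  simp only [alpha, reebFlow, inner_add_left, inner_add_right, real_inner_smul_left,
    real_inner_smul_right, h1, h3]
  rw [real_inner_comm] at h2
  have h2' : ⟪e.1, v.2⟫ = -⟪e.2, v.1⟫ := by rw [real_inner_comm v.1]; linarith
  rw [h2']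
  linear_combination ⟪e.2, v.1⟫ * Real.cos_sq_add_sin_sq (2 * t)

theorem IsLegendrianEmbedding.reebFlow {f : ℝ × ℝ → V4 × V4} (hf : IsLegendrianEmbedding f) (t : ℝ) :
    IsLegendrianEmbedding fun x => reebFlow t (f x) := by
  have hd := hf.torusMap.smooth.differentiable (by simp)
  have hinj : Function.Injective (UnknotLift.reebFlow t) :=
    Function.LeftInverse.injective (reebFlow_neg_reebFlow t)
  refine ⟨⟨(reebFlowL t).contDiff.comp hf.torusMap.smooth, fun x m n => ?_⟩,
    fun x => reebFlow_mem (hf.mem x) t, fun x v => ?_, fun x => ?_, fun x y h => ?_⟩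
  · rw [hf.torusMap.periodic]
  · rw [fderiv_reebFlow_comp (hd x), alpha_reebFlow (fderiv_mem_tangentUTS3 hd hf.mem x v),
      hf.legendrian]
  · intro v w h
    rw [fderiv_reebFlow_comp (hd x), fderiv_reebFlow_comp (hd x)] at h
    exact hf.immersion x (hinj h)
  · exact hf.injective x y (hinj h)

/-- The areas swept by the projection of a curve in the conormal torus of the great circle. -/
theorem swept_proj {c : ℝ → V4 × V4} (hs : ContDiff ℝ ∞ c) (hc : ∀ t, c t ∈ range greatTorus) (t : ℝ) :
    swept (fun t => (proj (c t)).1) t + swept (fun t => (proj (c t)).2) t =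
      -2 * ((c t).1 0 * deriv (fun t => (c t).1 1) t - (c t).1 1 * deriv (fun t => (c t).1 0) t) := by
  simp only [range_greatTorus, mem_ofPred_eq] at hc
  have hq : ∀ i, HasDerivAt (fun t => (c t).1 i) (deriv (fun t => (c t).1 i) t) t := fun i =>
    ((contDiff_euclidean.1 (contDiff_fst.comp hs) i).differentiable (by simp) t).hasDerivAt
  have hp : ∀ i, HasDerivAt (fun t => (c t).2 i) (deriv (fun t => (c t).2 i) t) t := fun i =>
    ((contDiff_euclidean.1 (contDiff_snd.comp hs) i).differentiable (by simp) t).hasDerivAt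
  have e10 : (fun t => (proj (c t)).1 0) = fun t => (c t).1 0 * (c t).2 3 + (c t).1 1 * (c t).2 2 := by
    funext t
    obtain ⟨-, ⟨h2, h3⟩, h0, h1⟩ := hc t
    simp [proj, pluecker, h0, h1, h2, h3]
  have e11 : (fun t => (proj (c t)).1 1) = fun t => (c t).1 0 * (c t).2 2 - (c t).1 1 * (c t).2 3 := by
    funext t
    obtain ⟨-, ⟨h2, h3⟩, h0, h1⟩ := hc t
    simp [proj, pluecker, h0, h1, h2, h3]
  have e20 : (fun t => (proj (c t)).2 0) = fun t => (c t).1 0 * (c t).2 3 - (c t).1 1 * (c t).2 2 := by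
    funext t
    obtain ⟨-, ⟨h2, h3⟩, h0, h1⟩ := hc t
    simp [proj, pluecker, h0, h1, h2, h3]
  have e21 : (fun t => (proj (c t)).2 1) =
      fun t => -((c t).1 0 * (c t).2 2) - (c t).1 1 * (c t).2 3 := by
    funext t
    obtain ⟨-, ⟨h2, h3⟩, h0, h1⟩ := hc t
    simp [proj, pluecker, h0, h1, h2, h3]
  have d10 := ((((hq 0).mul (hp 3)).add ((hq 1).mul (hp 2))).congr_of_eventuallyEq
    (.of_forall (congrFun e10))).deriv
  have d11 := ((((hq 0).mul (hp 2)).sub ((hq 1).mul (hp 3))).congr_of_eventuallyEq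
    (.of_forall (congrFun e11))).deriv
  have d20 := ((((hq 0).mul (hp 3)).sub ((hq 1).mul (hp 2))).congr_of_eventuallyEq
    (.of_forall (congrFun e20))).deriv
  have d21 := ((((hq 0).mul (hp 2)).neg.sub ((hq 1).mul (hp 3))).congr_of_eventuallyEq
    (.of_forall (congrFun e21))).deriv
  obtain ⟨hu, ⟨h2, h3⟩, h0, h1⟩ := hc t
  have pp := (mem_UTS3.1 hu).2.2
  rw [inner_V4, h0, h1] at pp
  rw [swept, swept, d10, d11, d20, d21, congrFun e10 t, congrFun e11 t, congrFun e20 t, congrFun e21 t]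
  linear_combination (-2 * ((c t).1 0 * deriv (fun t => (c t).1 1) t
    - (c t).1 1 * deriv (fun t => (c t).1 0) t)) * pp

/-- The area of a disc whose boundary lifts to a curve in the conormal torus of the great circle. -/
theorem IsDisc.exists_area_eq_of_lift {u : ℝ × ℝ → V3 × V3} (hu : IsDisc u) {c : ℝ → V4 × V4}
    (hs : ContDiff ℝ ∞ c) (hc : ∀ t, c t ∈ range greatTorus)
    (hb : ∀ θ ∈ Icc (0 : ℝ) 1, u (1, θ) = proj (c θ)) :
    ∃ n : ℤ, area u = -2 * (∫ t in (0 : ℝ)..1,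
      ((c t).1 0 * deriv (fun t => (c t).1 1) t - (c t).1 1 * deriv (fun t => (c t).1 0) t))
      + n * Real.pi := by
  have hps : ContDiff ℝ ∞ fun t => proj (c t) := contDiff_proj.comp hs
  obtain ⟨n, hn⟩ := hu.exists_area_eq (c := fun t => proj (c t)) (fun θ _ => by
    obtain ⟨x, hx⟩ := hc θ
    rw [← range_proj_greatTorus, ← hx]
    exact mem_range_self x) hb
  refine ⟨n, ?_⟩
  have h1 : ContDiff ℝ ∞ fun t => (proj (c t)).1 := contDiff_fst.comp hps
  have h2 : ContDiff ℝ ∞ fun t => (proj (c t)).2 := contDiff_snd.comp hps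
  rw [hn, ← intervalIntegral.integral_const_mul, ← intervalIntegral.integral_add
    ((continuous_swept h1).intervalIntegrable _ _) ((continuous_swept h2).intervalIntegrable _ _)]
  simp only [swept_proj hs hc]

/-- Along $x+tv$ the two angles move at rates proportional to $v_1+v_2$ and $v_2-v_1$, and a point
on a circle is at rest only if its angle is. -/
theorem injective_fderiv_proj_greatTorus (x : ℝ × ℝ) :
    Function.Injective (fderiv ℝ (fun x => proj (greatTorus x)) x) := by
  rw [injective_iff_map_eq_zero]
  intro v hv
  have hd : DifferentiableAt ℝ (fun x => proj (greatTorus x)) x :=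
    (contDiff_proj.comp isTorusMap_greatTorus.smooth).differentiable (by simp) x
  have hl : HasDerivAt (fun t : ℝ => x + t • v) v 0 := by
    simpa using ((hasDerivAt_id (0 : ℝ)).smul_const v).const_add x
  have hc : HasDerivAt (fun t : ℝ => proj (greatTorus (x + t • v))) 0 0 := by
    rw [← hv]
    exact hd.hasFDerivAt.comp_hasDerivAt_of_eq 0 hl (by simp)
  have key : ∀ a b : ℝ, HasDerivAt (fun t => Real.sin (2 * Real.pi * (a + t * b)) / 2) 0 0 →
      HasDerivAt (fun t => Real.cos (2 * Real.pi * (a + t * b)) / 2) 0 0 → b = 0 := by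
    intro a b h1 h2
    have hl : HasDerivAt (fun t : ℝ => 2 * Real.pi * (a + t * b)) (2 * Real.pi * b) 0 := by
      simpa using (((hasDerivAt_id (0 : ℝ)).mul_const b).const_add a).const_mul (2 * Real.pi)
    have h1' := (((Real.hasDerivAt_sin _).comp 0 hl).div_const 2).unique h1
    have h2' := (((Real.hasDerivAt_cos _).comp 0 hl).div_const 2).unique h2
    have h3 : b * Real.pi = 0 := by
      simp only [zero_mul, add_zero] at h1' h2'
      linear_combination Real.cos (2 * Real.pi * a) * h1' - Real.sin (2 * Real.pi * a) * h2'
        - b * Real.pi * Real.sin_sq_add_cos_sq (2 * Real.pi * a)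
    exact (mul_eq_zero.1 h3).resolve_right Real.pi_ne_zero
  have hf : (fun t : ℝ => proj (greatTorus (x + t • v))) = fun t =>
    (!₂[Real.sin (2 * Real.pi * (x.1 + x.2 + t * (v.1 + v.2))) / 2,
      Real.cos (2 * Real.pi * (x.1 + x.2 + t * (v.1 + v.2))) / 2, 0],
      !₂[Real.sin (2 * Real.pi * (x.2 - x.1 + t * (v.2 - v.1))) / 2,
        -Real.cos (2 * Real.pi * (x.2 - x.1 + t * (v.2 - v.1))) / 2, 0]) := by
    funext t
    rw [proj_greatTorus]
    have e1 : (x + t • v).1 + (x + t • v).2 = x.1 + x.2 + t * (v.1 + v.2) := by simp; ring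
    have e2 : (x + t • v).2 - (x + t • v).1 = x.2 - x.1 + t * (v.2 - v.1) := by simp; ring
    rw [e1, e2]
  rw [hf] at hc
  have coord : ∀ {c : ℝ → V3 × V3}, HasDerivAt c 0 0 → ∀ i,
      HasDerivAt (fun t => (c t).1 i) 0 0 ∧ HasDerivAt (fun t => (c t).2 i) 0 0 := fun h i =>
    ⟨hasDerivAt_coord ((ContinuousLinearMap.fst ℝ V3 V3).hasFDerivAt.comp_hasDerivAt 0 h) i,
      hasDerivAt_coord ((ContinuousLinearMap.snd ℝ V3 V3).hasFDerivAt.comp_hasDerivAt 0 h) i⟩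
  have k1 := key (x.1 + x.2) (v.1 + v.2) (by simpa using (coord hc 0).1) (by simpa using (coord hc 1).1)
  have k2 := key (x.2 - x.1) (v.2 - v.1) (by simpa using (coord hc 0).2)
    (by
      have := (coord hc 1).2.neg
      simp only [neg_zero] at this
      refine this.congr_of_eventuallyEq (.of_forall fun t => ?_)
      simp [neg_div])
  refine Prod.ext ?_ ?_ <;> simp only [Prod.fst_zero, Prod.snd_zero] <;> linarith

theorem sheets_greatTorus {y : V3 × V3} (hy : y ∈ productTorus) :
    {x ∈ Ico (0 : ℝ) 1 ×ˢ Ico (0 : ℝ) 1 | proj (greatTorus x) = y}.ncard = 2 := by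
  rw [← range_proj_greatTorus] at hy
  obtain ⟨x, hx⟩ := hy
  simp only at hx
  have hfr : ∀ r : ℝ, Int.fract r ∈ Ico (0 : ℝ) 1 := fun r => ⟨Int.fract_nonneg r, Int.fract_lt_one r⟩
  have hself : ∀ r ∈ Ico (0 : ℝ) 1, ∀ s : ℝ, ∀ m : ℤ, r - s = m → r = Int.fract s := by
    intro r hr s m h
    rw [← Int.fract_eq_self.2 hr, show r = s + m by linarith, Int.fract_add_intCast]
  have hset : {x ∈ Ico (0 : ℝ) 1 ×ˢ Ico (0 : ℝ) 1 | proj (greatTorus x) = y} =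
      {(Int.fract x.1, Int.fract x.2), (Int.fract (x.1 + 1 / 2), Int.fract (x.2 + 1 / 2))} := by
    ext z
    simp only [mem_ofPred_eq, mem_insert_iff, mem_singleton_iff, ← hx]
    constructor
    · rintro ⟨⟨hz1, hz2⟩, hz⟩
      rcases proj_greatTorus_eq_iff.1 hz.symm with ⟨m, n, h⟩ | ⟨m, n, h⟩
      · exact .inl (Prod.ext (hself _ hz1 _ m (congrArg Prod.fst h)) (hself _ hz2 _ n (congrArg Prod.snd h)))
      · have h1 := congrArg Prod.fst h
        have h2 := congrArg Prod.snd h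
        simp only [Prod.fst_sub, Prod.snd_sub] at h1 h2
        exact .inr (Prod.ext (hself _ hz1 _ m (by linarith)) (hself _ hz2 _ n (by linarith)))
    · rintro (rfl | rfl)
      · refine ⟨⟨hfr _, hfr _⟩, (proj_greatTorus_eq_iff.2 (.inl ⟨-⌊x.1⌋, -⌊x.2⌋, Prod.ext ?_ ?_⟩)).symm⟩ <;>
        · simp only [Int.fract, Prod.fst_sub, Prod.snd_sub, Int.cast_neg]
          ring
      · refine ⟨⟨hfr _, hfr _⟩, (proj_greatTorus_eq_iff.2 (.inr ⟨-⌊x.1 + 1 / 2⌋, -⌊x.2 + 1 / 2⌋,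
          Prod.ext ?_ ?_⟩)).symm⟩ <;>
        · simp only [Int.fract, Prod.fst_sub, Prod.snd_sub, Int.cast_neg]
          ring
  rw [hset]
  refine ncard_pair fun h => ?_
  have h1 := congrArg Prod.fst h
  simp only at h1
  obtain ⟨k, hk⟩ := Int.fract_eq_fract.1 h1
  have : ((2 * k + 1 : ℤ) : ℝ) = 0 := by push_cast; linarith
  have : 2 * k + 1 = 0 := by exact_mod_cast this
  omega

/-- For the loop condition: the area is $-\pi\,\Delta a$ modulo $\pi$, where $\Delta a$ is the
change of the first coordinate. A path over a loop has both coordinate changes integral or both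
half-integral, and the area tells these cases apart. -/
theorem isCanonicalCover_greatTorus : IsCanonicalCover productTorus 2 fun x => proj (greatTorus x) where
  minimal := isLeast_actionIn
  torusMap := ⟨contDiff_proj.comp isTorusMap_greatTorus.smooth, fun x m n => by
    rw [isTorusMap_greatTorus.periodic]⟩
  immersion := injective_fderiv_proj_greatTorus
  image := range_proj_greatTorus
  sheets _ hy := sheets_greatTorus hy
  loops γ hγ h01 u hu hb := by
    obtain ⟨n, hn⟩ := hu.exists_area_eq_of_lift (c := fun t => greatTorus (γ t))
      (isTorusMap_greatTorus.smooth.comp hγ) (fun t => mem_range_self _) hb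
    have hγ1 : ContDiff ℝ ∞ fun t => (γ t).1 := contDiff_fst.comp hγ
    have hd : ∀ t, HasDerivAt (fun t => (γ t).1) (deriv (fun t => (γ t).1) t) t := fun t =>
      (hγ1.differentiable (by simp) t).hasDerivAt
    have hint : ∫ t in (0 : ℝ)..1, ((greatTorus (γ t)).1 0 * deriv (fun t => (greatTorus (γ t)).1 1) t
        - (greatTorus (γ t)).1 1 * deriv (fun t => (greatTorus (γ t)).1 0) t) =
        Real.pi / 2 * ((γ 1).1 - (γ 0).1) := by
      rw [← intervalIntegral.integral_deriv_eq_sub (f := fun t => (γ t).1)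
        (fun t _ => (hd t).differentiableAt) ((hγ1.continuous_deriv (by simp)).intervalIntegrable _ _),
        ← intervalIntegral.integral_const_mul]
      refine intervalIntegral.integral_congr fun t _ => ?_
      have hl : HasDerivAt (fun t : ℝ => 2 * Real.pi * (γ t).1)
          (2 * Real.pi * deriv (fun t => (γ t).1) t) t := (hd t).const_mul (2 * Real.pi)
      have h1 := (((Real.hasDerivAt_cos _).comp t hl).div_const 2).deriv
      have h2 := (((Real.hasDerivAt_sin _).comp t hl).div_const 2).deriv
      simp only [Function.comp_def] at h1 h2
      simp only [greatTorus, Matrix.cons_val, h1, h2]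
      linear_combination Real.pi / 2 * deriv (fun t => (γ t).1) t
        * Real.cos_sq_add_sin_sq (2 * Real.pi * (γ t).1)
    rw [hint] at hn
    constructor
    · rintro ⟨k, l, h⟩
      have h1 := congrArg Prod.fst h
      simp only [Prod.fst_sub] at h1
      refine ⟨n - k, ?_⟩
      rw [hn, h1]
      push_cast
      ring
    · rintro ⟨k, hk⟩
      refine (proj_greatTorus_eq_iff.1 h01).resolve_right ?_
      rintro ⟨m, l, h⟩
      have h1 := congrArg Prod.fst h
      simp only [Prod.fst_sub] at h1
      rw [hn, h1] at hk
      have h3 : ((2 * n - 2 * k - 2 * m - 1 : ℤ) : ℝ) * Real.pi = 0 := by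
        push_cast
        linarith
      rcases mul_eq_zero.1 h3 with h4 | h4
      · have : 2 * n - 2 * k - 2 * m - 1 = 0 := by exact_mod_cast h4
        omega
      · exact Real.pi_ne_zero h4

theorem isLegendrianLift_greatTorus : IsLegendrianLift (fun x => proj (greatTorus x)) greatTorus where
  torusMap := isTorusMap_greatTorus
  mem := greatTorus_mem
  legendrian x v := by
    have hd := isTorusMap_greatTorus.smooth.differentiable (by simp) x
    rw [alpha, inner_V4, fderiv_fst_coord hd, fderiv_fst_coord hd, fderiv_fst_coord hd,
      fderiv_fst_coord hd]
    simp [greatTorus]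
  lift _ := rfl

/-! ### Legendrian lifts of the canonical cover -/

/-- Being over both equators means $m_{01}=m_{23}=0$: in each of the two coordinate planes the
components of $q$ and $p$ are parallel. -/
theorem pluecker_of_proj_mem {e : V4 × V4} (h : proj e ∈ productTorus) :
    e.1 0 * e.2 1 = e.1 1 * e.2 0 ∧ e.1 2 * e.2 3 = e.1 3 * e.2 2 := by
  obtain ⟨-, h1, h2⟩ := h
  simp only [proj, pluecker, Matrix.cons_val] at h1 h2
  constructor <;> linarith

/-- Every fibre over the product torus meets the conormal torus of the great circle. -/
theorem exists_reebFlow_mem {e : V4 × V4} (h : proj e ∈ productTorus) :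
    ∃ t, (reebFlow t e).1 2 = 0 ∧ (reebFlow t e).1 3 = 0 := by
  obtain ⟨-, hm⟩ := pluecker_of_proj_mem h
  obtain ⟨a, b, hab, h2, h3⟩ : ∃ a b : ℝ, a ^ 2 + b ^ 2 = 1 ∧ a * e.1 2 + b / 2 * e.2 2 = 0 ∧
      a * e.1 3 + b / 2 * e.2 3 = 0 := by
    -- A unit combination $a\,q+\tfrac b2\,p$ without component in the second plane is sought. If
    -- $p$ has none, $p$ itself serves; otherwise that component of $q$ is $k$ times that of $p$,
    -- and $(a,b)$ is proportional to $(1,-2k)$.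
    by_cases h0 : e.2 2 ^ 2 + e.2 3 ^ 2 = 0
    · have h2 : e.2 2 = 0 := by nlinarith [sq_nonneg (e.2 2), sq_nonneg (e.2 3)]
      have h3 : e.2 3 = 0 := by nlinarith [sq_nonneg (e.2 2), sq_nonneg (e.2 3)]
      exact ⟨0, 1, by norm_num, by simp [h2], by simp [h3]⟩
    · obtain ⟨k, hk⟩ : ∃ k, k = (e.1 2 * e.2 2 + e.1 3 * e.2 3) / (e.2 2 ^ 2 + e.2 3 ^ 2) := ⟨_, rfl⟩
      have k2 : e.1 2 = k * e.2 2 := by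
        rw [hk]
        field_simp
        linear_combination e.2 3 * hm
      have k3 : e.1 3 = k * e.2 3 := by
        rw [hk]
        field_simp
        linear_combination -e.2 2 * hm
      have hr : 0 < 1 + 4 * k ^ 2 := by positivity
      have hr2 : √(1 + 4 * k ^ 2) ^ 2 = 1 + 4 * k ^ 2 := Real.sq_sqrt hr.le
      have hr0 : √(1 + 4 * k ^ 2) ≠ 0 := (Real.sqrt_pos.2 hr).ne'
      refine ⟨1 / √(1 + 4 * k ^ 2), -(2 * k) / √(1 + 4 * k ^ 2), ?_, ?_, ?_⟩
      · field_simp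
        rw [hr2]
        ring
      · rw [k2]
        ring
      · rw [k3]
        ring
  obtain ⟨t, hc, hs⟩ := exists_cos_sin hab
  refine ⟨t / 2, ?_, ?_⟩ <;>
    simpa [reebFlow, show 2 * (t / 2) = t by ring, hc, hs]

/-- A Legendrian over the product torus that meets the conormal torus of the great circle is contained
in it. -/
theorem mem_range_greatTorus_of_legendrian {g : ℝ × ℝ → V4 × V4} (hg : Differentiable ℝ g)
    (hm : ∀ x, g x ∈ UTS3) (hleg : ∀ x v, alpha (g x) (fderiv ℝ g x v) = 0)
    (hproj : ∀ x, proj (g x) ∈ productTorus) {x₀ : ℝ × ℝ} (h0 : (g x₀).1 2 = 0 ∧ (g x₀).1 3 = 0)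
    (x : ℝ × ℝ) : g x ∈ range greatTorus := by
  -- The span of $q$ and $p$ is spanned by one vector from each coordinate plane, so it contains the
  -- first-plane component $q'$ of $q$. A velocity of $q$ is orthogonal to $q$, and to $p$ by the
  -- Legendrian condition, hence to $q'$; so $|q'|^2$ has zero derivative. The linear combination
  -- below is this argument multiplied by $|p|^2=1$.
  have hconst : ∀ x, (g x).1 0 ^ 2 + (g x).1 1 ^ 2 = 1 / 4 := by
    have hd : ∀ i, Differentiable ℝ fun y => (g y).1 i := fun i x =>
      (differentiableAt_euclidean.1 (hg x).fst) i
    have hz : ∀ x, fderiv ℝ (fun y => (g y).1 0 ^ 2 + (g y).1 1 ^ 2) x = 0 := by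
      intro x
      refine ContinuousLinearMap.ext fun v => ?_
      obtain ⟨a1, a2⟩ := pluecker_of_proj_mem (hproj x)
      obtain ⟨-, qp, pp⟩ := mem_UTS3.1 (hm x)
      have t1 := (fderiv_mem_tangentUTS3 hg hm x v).1
      have t2 := hleg x v
      have hf : HasFDerivAt (fun y => (g y).1 0 ^ 2 + (g y).1 1 ^ 2) _ x :=
        ((hd 0 x).hasFDerivAt.pow 2).add ((hd 1 x).hasFDerivAt.pow 2)
      rw [hf.fderiv]
      simp only [alpha, inner_V4] at t1 t2 qp pp
      simp [← fderiv_fst_coord (hg x)]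
      have : ((g x).1 0 * (fderiv ℝ g x v).1 0 + (g x).1 1 * (fderiv ℝ g x v).1 1) = 0 := by
        linear_combination (-((g x).1 0 * (fderiv ℝ g x v).1 0 + (g x).1 1 * (fderiv ℝ g x v).1 1)) * pp
          + ((fderiv ℝ g x v).1 0 * (g x).2 1 - (fderiv ℝ g x v).1 1 * (g x).2 0) * a1
          - ((fderiv ℝ g x v).1 2 * (g x).2 3 - (fderiv ℝ g x v).1 3 * (g x).2 2) * a2
          + ((g x).2 2 ^ 2 + (g x).2 3 ^ 2) * t1
          - ((g x).1 2 * (g x).2 2 + (g x).1 3 * (g x).2 3) * t2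
          + ((g x).2 0 * (fderiv ℝ g x v).1 0 + (g x).2 1 * (fderiv ℝ g x v).1 1) * qp
      linarith
    intro x
    have h1 := is_const_of_fderiv_eq_zero (𝕜 := ℝ) (((hd 0).pow 2).add ((hd 1).pow 2)) hz x x₀
    have h2 := (mem_UTS3.1 (hm x₀)).1
    rw [inner_V4, h0.1, h0.2] at h2
    simp only [Pi.add_apply, Pi.pow_apply] at h1
    rw [h1]
    linarith
  rw [range_greatTorus]
  obtain ⟨qq, qp, -⟩ := mem_UTS3.1 (hm x)
  obtain ⟨a1, -⟩ := pluecker_of_proj_mem (hproj x)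
  have hA := hconst x
  rw [inner_V4] at qq qp
  have q2 : (g x).1 2 = 0 := by nlinarith [sq_nonneg ((g x).1 2), sq_nonneg ((g x).1 3)]
  have q3 : (g x).1 3 = 0 := by nlinarith [sq_nonneg ((g x).1 2), sq_nonneg ((g x).1 3)]
  rw [q2, q3] at qp
  -- The first-plane component of $p$ is both parallel and orthogonal to $q\neq 0$, so it vanishes.
  refine ⟨hm x, ⟨q2, q3⟩, ?_, ?_⟩
  · linear_combination (-4 * (g x).2 0) * hA + 4 * (g x).1 0 * qp - 4 * (g x).1 1 * a1
  · linear_combination (-4 * (g x).2 1) * hA + 4 * (g x).1 1 * qp + 4 * (g x).1 0 * a1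

/-- A Legendrian lift of the canonical cover is a Legendrian embedding whose image is obtained from the
conormal torus of the great circle by the Reeb flow. -/
theorem IsLegendrianLift.embedding {ι : ℝ × ℝ → V3 × V3} {f : ℝ × ℝ → V4 × V4}
    (hι : IsCanonicalCover productTorus 2 ι) (hf : IsLegendrianLift ι f) :
    IsLegendrianEmbedding f ∧ ∃ t, range f = reebFlow t '' range greatTorus := by
  have hproj : ∀ x, proj (f x) ∈ productTorus := fun x => by
    rw [hf.lift, ← hι.image]
    exact mem_range_self x
  have hd := hf.torusMap.smooth.differentiable (by simp)
  obtain ⟨t, ht⟩ := exists_reebFlow_mem (hproj 0)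
  set g : ℝ × ℝ → V4 × V4 := fun x => reebFlow t (f x) with hgdef
  have hgs : ContDiff ℝ ∞ g := (reebFlowL t).contDiff.comp hf.torusMap.smooth
  have hgι : ∀ x, proj (g x) = ι x := fun x => by rw [hgdef, proj_reebFlow, hf.lift]
  have hg : ∀ x, g x ∈ range greatTorus := by
    refine mem_range_greatTorus_of_legendrian (hgs.differentiable (by simp))
      (fun x => reebFlow_mem (hf.mem x) t) (fun x v => ?_) (fun x => ?_) ht
    · rw [hgdef, fderiv_reebFlow_comp (hd x), alpha_reebFlow (fderiv_mem_tangentUTS3 hd hf.mem x v),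
        hf.legendrian]
    · rw [hgdef, proj_reebFlow]
      exact hproj x
  -- The segment from `x` to `y` maps to a loop in the product torus that lifts to a closed curve in
  -- the model torus. There $q$ winds $m$ times, so a bounding disc has area $-\pi m$ modulo $\pi$,
  -- and the cover property makes `y - x` integral.
  have hinj : ∀ x y, g x = g y → ∃ m n : ℤ, y - x = ((m : ℝ), (n : ℝ)) := by
    intro x y hxy
    set γ : ℝ → ℝ × ℝ := fun θ => x + θ • (y - x) with hγdef
    have hγ : ContDiff ℝ ∞ γ := by unfold γ; fun_prop
    have γ0 : γ 0 = x := by simp [hγdef]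
    have γ1 : γ 1 = y := by simp [hγdef]
    have h01 : ι (γ 0) = ι (γ 1) := by rw [γ0, γ1, ← hgι, ← hgι, hxy]
    obtain ⟨u, hu, hb⟩ := exists_disc (c := fun θ => ι (γ θ)) (hι.torusMap.smooth.comp hγ)
      (fun θ => hι.image ▸ mem_range_self _) h01
    have hcs : ContDiff ℝ ∞ fun θ => g (γ θ) := hgs.comp hγ
    obtain ⟨n, hn⟩ := hu.exists_area_eq_of_lift hcs (fun θ => hg _)
      (fun θ _ => by rw [hb, hgι])
    obtain ⟨m, hm⟩ := exists_winding (r := 1 / 4) (by norm_num)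
      (contDiff_euclidean.1 (contDiff_fst.comp hcs) 0) (contDiff_euclidean.1 (contDiff_fst.comp hcs) 1)
      (fun θ _ => by
        have h := hg (γ θ)
        rw [range_greatTorus] at h
        obtain ⟨h1, ⟨h2, h3⟩, -⟩ := h
        have h4 := (mem_UTS3.1 h1).1
        rw [inner_V4, h2, h3] at h4
        simp only [Function.comp]
        linarith)
      (by simp only [Function.comp, γ0, γ1, hxy]) (by simp only [Function.comp, γ0, γ1, hxy])
    simp only [Function.comp_def] at hm
    have := (hι.loops γ hγ h01 u hu fun θ _ => hb θ).2 ⟨n - m, by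
      rw [hn, hm]
      push_cast
      ring⟩
    rwa [γ0, γ1] at this
  -- Over each point both the model torus and `ι` have two sheets. The two points of `ι` have
  -- distinct images under `g` by injectivity, so these images exhaust the fibre of the model torus.
  have hrange : range g = range greatTorus := by
    refine Subset.antisymm (range_subset_iff.2 hg) (range_subset_iff.2 fun x => ?_)
    have hy : proj (greatTorus x) ∈ productTorus := by
      rw [← range_proj_greatTorus]
      exact mem_range_self x
    obtain ⟨y, z, hyz, hset⟩ := ncard_eq_two.1 (hι.sheets _ hy)
    have hys : y ∈ ({y, z} : Set (ℝ × ℝ)) := mem_insert _ _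
    have hzs : z ∈ ({y, z} : Set (ℝ × ℝ)) := mem_insert_of_mem _ rfl
    rw [← hset] at hys hzs
    obtain ⟨⟨hy1, hy2⟩, hyι⟩ := hys
    obtain ⟨⟨hz1, hz2⟩, hzι⟩ := hzs
    obtain ⟨a, ha⟩ := hg y
    obtain ⟨b, hb⟩ := hg z
    rw [← hgι, ← ha] at hyι
    rw [← hgι, ← hb] at hzι
    rcases proj_greatTorus_eq_iff.1 hyι with h | ⟨m, n, h⟩
    · exact ⟨y, by rw [← ha, greatTorus_eq_iff.2 h]⟩
    rcases proj_greatTorus_eq_iff.1 hzι with h' | ⟨m', n', h'⟩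
    · exact ⟨z, by rw [← hb, greatTorus_eq_iff.2 h']⟩
    have hab : greatTorus a = greatTorus b := by
      refine greatTorus_eq_iff.2 ⟨m - m', n - n', ?_⟩
      rw [show b - a = (x - a) - (x - b) by abel, h, h']
      refine Prod.ext ?_ ?_ <;> push_cast [Prod.fst_sub, Prod.snd_sub] <;> ring
    obtain ⟨k, l, hkl⟩ := hinj y z (by rw [← ha, ← hb, hab])
    refine absurd ?_ hyz
    have h1 := congrArg Prod.fst hkl
    have h2 := congrArg Prod.snd hkl
    simp only [Prod.fst_sub, Prod.snd_sub] at h1 h2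
    have key : ∀ r ∈ Ico (0 : ℝ) 1, ∀ s ∈ Ico (0 : ℝ) 1, ∀ k : ℤ, s - r = k → r = s := by
      intro r hr s hs k hk
      have k1 : (k : ℝ) < 1 := by linarith [hr.1, hs.2]
      have k2 : (-1 : ℝ) < k := by linarith [hr.2, hs.1]
      have k1' : k < 1 := by exact_mod_cast k1
      have k2' : -1 < k := by exact_mod_cast k2
      obtain rfl : k = 0 := by omega
      simp at hk
      linarith
    exact Prod.ext (key _ hy1 _ hz1 k h1) (key _ hy2 _ hz2 l h2)
  refine ⟨⟨hf.torusMap, hf.mem, hf.legendrian, fun x => ?_, fun x y h => ?_⟩, -t, ?_⟩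
  -- Immersivity is inherited from `ι`, which factors through `f`.
  · have h1 : fderiv ℝ ι x = (fderiv ℝ proj (f x)).comp (fderiv ℝ f x) := by
      rw [← fderiv_comp x (contDiff_proj.differentiable (by simp) _) (hd x)]
      congr 1
      funext y
      exact (hf.lift y).symm
    have h2 := hι.immersion x
    rw [h1] at h2
    exact Function.Injective.of_comp (f := fderiv ℝ proj (f x)) h2
  · exact hinj x y (congrArg (reebFlow t) h)
  · rw [← hrange, ← range_comp]
    congr 1
    funext x
    exact (reebFlow_neg_reebFlow t (f x)).symm

/-! ### Conormal lifts of unknots -/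

/-- The radial projection to the sphere of radius `1/2`. -/
noncomputable def radial (x : V4) : V4 := (2 * ‖x‖)⁻¹ • x

/-- The homogeneous extension to `ℝ⁴ ∖ 0` of a self-map of the sphere. -/
@[irreducible]
noncomputable def homExt (φ : V4 → V4) (x : V4) : V4 := (2 * ‖x‖) • φ (radial x)

/-- A diffeomorphism `φ` of the three-sphere with inverse `ψ`. -/
structure IsSphereDiffeo (φ ψ : V4 → V4) : Prop where
  smooth : ContDiffOn ℝ ∞ φ S3
  inv_smooth : ContDiffOn ℝ ∞ ψ S3
  bijOn : BijOn φ S3 S3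
  left_inv : ∀ x ∈ S3, ψ (φ x) = x

/-- The cotangent lift of a self-map `φ` of the sphere, applied to the conormal torus of the great circle. -/
noncomputable def conormalMap (φ : V4 → V4) (x : ℝ × ℝ) : V4 × V4 :=
  (homExt φ (greatTorus x).1,
    ‖ContinuousLinearMap.adjoint (fderiv ℝ (homExt φ) (greatTorus x).1).inverse (greatTorus x).2‖⁻¹ •
      ContinuousLinearMap.adjoint (fderiv ℝ (homExt φ) (greatTorus x).1).inverse (greatTorus x).2)

theorem norm_of_mem_S3 {x : V4} (hx : x ∈ S3) : ‖x‖ = 1 / 2 := hx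

theorem ne_zero_of_mem_S3 {x : V4} (hx : x ∈ S3) : x ≠ 0 := by
  rintro rfl
  have := norm_of_mem_S3 hx
  simp at this

theorem radial_mem {x : V4} (hx : x ≠ 0) : radial x ∈ S3 := by
  have h : ‖x‖ ≠ 0 := norm_ne_zero_iff.2 hx
  change ‖radial x‖ = 1 / 2
  rw [radial, norm_smul, norm_inv, norm_mul, norm_norm, Real.norm_two]
  field_simp

theorem radial_smul {x : V4} (hx : x ∈ S3) {c : ℝ} (hc : 0 < c) : radial (c • x) = x := by
  rw [radial, norm_smul, norm_of_mem_S3 hx, Real.norm_of_nonneg hc.le, smul_smul]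
  have : (2 * (c * (1 / 2)))⁻¹ * c = 1 := by field_simp
  rw [this, one_smul]

theorem homExt_smul (φ : V4 → V4) {x : V4} (hx : x ∈ S3) {c : ℝ} (hc : 0 < c) :
    homExt φ (c • x) = c • φ x := by
  rw [homExt, radial_smul hx hc, norm_smul, norm_of_mem_S3 hx, Real.norm_of_nonneg hc.le]
  congr 1
  ring

theorem homExt_of_mem (φ : V4 → V4) {x : V4} (hx : x ∈ S3) : homExt φ x = φ x := by
  simpa using homExt_smul φ hx one_pos

theorem smul_radial {x : V4} (hx : x ≠ 0) : (2 * ‖x‖) • radial x = x := by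
  rw [radial, smul_smul, mul_inv_cancel₀, one_smul]
  exact mul_ne_zero two_ne_zero (norm_ne_zero_iff.2 hx)

theorem contDiffOn_homExt_joint {φ : ℝ → V4 → V4} {s : Set ℝ}
    (hφ : ContDiffOn ℝ ∞ (fun x : ℝ × V4 => φ x.1 x.2) (s ×ˢ S3)) :
    ContDiffOn ℝ ∞ (fun x : ℝ × V4 => homExt (φ x.1) x.2) (s ×ˢ {0}ᶜ) := by
  have hn : ContDiffOn ℝ ∞ (fun x : ℝ × V4 => 2 * ‖x.2‖) (s ×ˢ {0}ᶜ) :=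
    contDiffOn_const.mul (contDiff_snd.contDiffOn.norm ℝ fun x hx => hx.2)
  have hr : ContDiffOn ℝ ∞ (fun x : ℝ × V4 => radial x.2) (s ×ˢ {0}ᶜ) :=
    (hn.inv fun x hx => mul_ne_zero two_ne_zero (norm_ne_zero_iff.2 hx.2)).smul contDiff_snd.contDiffOn
  unfold homExt
  exact hn.smul (hφ.comp (contDiff_fst.contDiffOn.prodMk hr) fun x hx => ⟨hx.1, radial_mem hx.2⟩)

theorem contDiffOn_homExt {φ : V4 → V4} (hφ : ContDiffOn ℝ ∞ φ S3) :
    ContDiffOn ℝ ∞ (homExt φ) {0}ᶜ := by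
  have h := contDiffOn_homExt_joint (φ := fun _ => φ) (s := univ)
    (hφ.comp contDiff_snd.contDiffOn fun x hx => hx.2)
  exact h.comp (f := fun x : V4 => ((0 : ℝ), x)) (contDiff_const.prodMk contDiff_id).contDiffOn
    fun x hx => ⟨trivial, hx⟩

theorem contDiffAt_homExt {φ : V4 → V4} (hφ : ContDiffOn ℝ ∞ φ S3) {x : V4} (hx : x ≠ 0) :
    ContDiffAt ℝ ∞ (homExt φ) x :=
  (contDiffOn_homExt hφ).contDiffAt (isOpen_compl_singleton.mem_nhds hx)

theorem hasFDerivAt_homExt {φ : V4 → V4} (hφ : ContDiffOn ℝ ∞ φ S3) {x : V4} (hx : x ≠ 0) :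
    HasFDerivAt (homExt φ) (fderiv ℝ (homExt φ) x) x :=
  ((contDiffAt_homExt hφ hx).differentiableAt (by simp)).hasFDerivAt

/-! ### Cotangent lifts of diffeomorphisms of the sphere -/

namespace IsSphereDiffeo

variable {φ ψ : V4 → V4}

theorem symm (h : IsSphereDiffeo φ ψ) : IsSphereDiffeo ψ φ := by
  have hr : ∀ y ∈ S3, ψ y ∈ S3 ∧ φ (ψ y) = y := by
    intro y hy
    obtain ⟨x, hx, rfl⟩ := h.bijOn.surjOn hy
    rw [h.left_inv x hx]
    exact ⟨hx, rfl⟩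
  refine ⟨h.inv_smooth, h.smooth, ⟨fun y hy => (hr y hy).1, fun y hy y' hy' e => ?_, fun x hx => ?_⟩,
    fun y hy => (hr y hy).2⟩
  · rw [← (hr y hy).2, e, (hr y' hy').2]
  · exact ⟨φ x, h.bijOn.mapsTo hx, h.left_inv x hx⟩

theorem homExt_ne_zero (h : IsSphereDiffeo φ ψ) {x : V4} (hx : x ≠ 0) : homExt φ x ≠ 0 := by
  rw [homExt]
  exact smul_ne_zero (mul_ne_zero two_ne_zero (norm_ne_zero_iff.2 hx))
    (ne_zero_of_mem_S3 (h.bijOn.mapsTo (radial_mem hx)))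

theorem homExt_homExt (h : IsSphereDiffeo φ ψ) {x : V4} (hx : x ≠ 0) :
    homExt ψ (homExt φ x) = x := by
  have hp : 0 < 2 * ‖x‖ := by positivity
  conv_lhs => rw [← smul_radial hx]
  rw [homExt_smul φ (radial_mem hx) hp, homExt_smul ψ (h.bijOn.mapsTo (radial_mem hx)) hp,
    h.left_inv _ (radial_mem hx), smul_radial hx]

theorem fderiv_comp_fderiv (h : IsSphereDiffeo φ ψ) {x : V4} (hx : x ≠ 0) :
    (fderiv ℝ (homExt ψ) (homExt φ x)).comp (fderiv ℝ (homExt φ) x) = ContinuousLinearMap.id ℝ V4 := by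
  refine HasFDerivAt.unique (((hasFDerivAt_homExt h.inv_smooth (h.homExt_ne_zero hx)).comp x
    (hasFDerivAt_homExt h.smooth hx)).congr_of_eventuallyEq ?_) (hasFDerivAt_id x)
  filter_upwards [isOpen_compl_singleton.mem_nhds hx] with y hy
  exact (h.homExt_homExt hy).symm

theorem exists_fderiv_eq (h : IsSphereDiffeo φ ψ) {x : V4} (hx : x ≠ 0) :
    ∃ e : V4 ≃L[ℝ] V4, fderiv ℝ (homExt φ) x = e := by
  have h1 := h.fderiv_comp_fderiv hx
  have h2 := h.symm.fderiv_comp_fderiv (h.homExt_ne_zero hx)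
  rw [h.homExt_homExt hx] at h2
  exact ⟨ContinuousLinearEquiv.equivOfInverse _ _ (fun v => congrArg (fun l : V4 →L[ℝ] V4 => l v) h1)
    (fun v => congrArg (fun l : V4 →L[ℝ] V4 => l v) h2), rfl⟩

/-- Euler's identity. -/
theorem fderiv_self (h : IsSphereDiffeo φ ψ) {x : V4} (hx : x ∈ S3) :
    fderiv ℝ (homExt φ) x x = φ x := by
  have h1 : HasDerivAt (fun c : ℝ => homExt φ (c • x)) (fderiv ℝ (homExt φ) x x) 1 :=
    (hasFDerivAt_homExt h.smooth (ne_zero_of_mem_S3 hx)).comp_hasDerivAt_of_eq 1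
      (by simpa using (hasDerivAt_id (1 : ℝ)).smul_const x) (by simp)
  have h2 : HasDerivAt (fun c : ℝ => homExt φ (c • x)) (φ x) 1 := by
    have h3 : HasDerivAt (fun c : ℝ => c • φ x) (φ x) 1 := by
      simpa using (hasDerivAt_id (1 : ℝ)).smul_const (φ x)
    refine h3.congr_of_eventuallyEq ?_
    filter_upwards [lt_mem_nhds one_pos] with c hc
    exact homExt_smul φ hx hc
  exact h1.unique h2

end IsSphereDiffeo

theorem adjoint_apply_coord (A : V4 →L[ℝ] V4) (p : V4) (i : Fin 4) :
    ContinuousLinearMap.adjoint A p i = ⟪p, A (EuclideanSpace.single i 1)⟫ := by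
  rw [← ContinuousLinearMap.adjoint_inner_left, EuclideanSpace.inner_single_right]
  simp

theorem contDiffWithinAt_adjoint_apply {E : Type*} [NormedAddCommGroup E] [NormedSpace ℝ E]
    {A : E → V4 →L[ℝ] V4} {p : E → V4} {s : Set E} {x : E} (hA : ContDiffWithinAt ℝ ∞ A s x)
    (hp : ContDiffWithinAt ℝ ∞ p s x) :
    ContDiffWithinAt ℝ ∞ (fun y => ContinuousLinearMap.adjoint (A y) (p y)) s x := by
  rw [contDiffWithinAt_euclidean]
  intro i
  simp only [adjoint_apply_coord]
  exact hp.inner ℝ (hA.clm_apply contDiffWithinAt_const)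

theorem contDiffWithinAt_normalize {E : Type*} [NormedAddCommGroup E] [NormedSpace ℝ E]
    {p : E → V4} {s : Set E} {x : E} (hp : ContDiffWithinAt ℝ ∞ p s x) (h0 : p x ≠ 0) :
    ContDiffWithinAt ℝ ∞ (fun y => ‖p y‖⁻¹ • p y) s x :=
  ((hp.norm ℝ h0).inv (norm_ne_zero_iff.2 h0)).smul hp

theorem greatTorus_fst_mem (x : ℝ × ℝ) : (greatTorus x).1 ∈ S3 := (greatTorus_mem x).1

theorem greatTorus_fst_ne_zero (x : ℝ × ℝ) : (greatTorus x).1 ≠ 0 :=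
  ne_zero_of_mem_S3 (greatTorus_fst_mem x)

theorem greatTorus_snd_ne_zero (x : ℝ × ℝ) : (greatTorus x).2 ≠ 0 :=
  norm_ne_zero_iff.1 (by rw [(greatTorus_mem x).2.2]; exact one_ne_zero)

namespace IsSphereDiffeo

variable {φ ψ : V4 → V4}

/-- The transported covector $P$ is characterised by $\langle P,d\Phi\,v\rangle=\langle p,v\rangle$,
with $\Phi$ the homogeneous extension. This pairing, or its adjoint form, replaces the explicit
inverse transpose in what follows. -/
theorem conormalMap_eq (h : IsSphereDiffeo φ ψ) (x : ℝ × ℝ) :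
    ∃ (e : V4 ≃L[ℝ] V4) (P : V4), fderiv ℝ (homExt φ) (greatTorus x).1 = e ∧ P ≠ 0 ∧
      P = ContinuousLinearMap.adjoint (fderiv ℝ (homExt φ) (greatTorus x).1).inverse (greatTorus x).2 ∧
      ContinuousLinearMap.adjoint (e : V4 →L[ℝ] V4) P = (greatTorus x).2 ∧
      (∀ v, ⟪P, e v⟫ = ⟪(greatTorus x).2, v⟫) ∧
      conormalMap φ x = (φ (greatTorus x).1, ‖P‖⁻¹ • P) := by
  obtain ⟨e, he⟩ := h.exists_fderiv_eq (greatTorus_fst_ne_zero x)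
  have hin : ∀ v, ⟪ContinuousLinearMap.adjoint (e.symm : V4 →L[ℝ] V4) (greatTorus x).2, e v⟫ =
      ⟪(greatTorus x).2, v⟫ := by
    intro v
    rw [ContinuousLinearMap.adjoint_inner_left]
    simp
  have hadj : ContinuousLinearMap.adjoint (e : V4 →L[ℝ] V4)
      (ContinuousLinearMap.adjoint (e.symm : V4 →L[ℝ] V4) (greatTorus x).2) = (greatTorus x).2 := by
    refine ext_inner_right ℝ fun v => ?_
    rw [ContinuousLinearMap.adjoint_inner_left]
    exact hin v
  refine ⟨e, _, he, fun h0 => ?_, rfl, ?_, ?_, ?_⟩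
  · rw [he, ContinuousLinearMap.inverse_equiv] at h0
    rw [h0, map_zero] at hadj
    exact greatTorus_snd_ne_zero x hadj.symm
  · rw [he, ContinuousLinearMap.inverse_equiv]
    exact hadj
  · rw [he, ContinuousLinearMap.inverse_equiv]
    exact hin
  · rw [conormalMap, homExt_of_mem φ (greatTorus_fst_mem x)]

theorem conormalMap_mem (h : IsSphereDiffeo φ ψ) (x : ℝ × ℝ) : conormalMap φ x ∈ UTS3 := by
  obtain ⟨e, P, he, hP, -, -, hin, heq⟩ := h.conormalMap_eq x
  have hq := greatTorus_fst_mem x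
  rw [heq]
  refine ⟨h.bijOn.mapsTo hq, ?_, ?_⟩
  · simp only [real_inner_smul_right]
    -- By Euler's identity $\varphi(q)=d\Phi(q)$, so the pairing with $P$ is $\langle q,p\rangle=0$.
    -- Extending with degree one is what keeps covectors tangent to the sphere.
    rw [← h.fderiv_self hq, he, real_inner_comm, ContinuousLinearEquiv.coe_coe, hin,
      real_inner_comm, (greatTorus_mem x).2.1, mul_zero]
  · simp only [norm_smul, norm_inv, norm_norm]
    exact inv_mul_cancel₀ (norm_ne_zero_iff.2 hP)

/-- The inverse of the cotangent lift. -/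
theorem exists_leftInverse (h : IsSphereDiffeo φ ψ) : ∃ H : V4 × V4 → V4 × V4,
    ∀ x, H (conormalMap φ x) = greatTorus x ∧ DifferentiableAt ℝ H (conormalMap φ x) := by
  refine ⟨fun e => (homExt ψ e.1,
    ‖ContinuousLinearMap.adjoint (fderiv ℝ (homExt φ) (homExt ψ e.1)) e.2‖⁻¹ •
      ContinuousLinearMap.adjoint (fderiv ℝ (homExt φ) (homExt ψ e.1)) e.2), fun x => ?_⟩
  obtain ⟨e, P, he, hP, -, hadj, -, heq⟩ := h.conormalMap_eq x
  have hq := greatTorus_fst_mem x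
  have hψ : homExt ψ (φ (greatTorus x).1) = (greatTorus x).1 := by
    rw [homExt_of_mem ψ (h.bijOn.mapsTo hq), h.left_inv _ hq]
  have hA : ContinuousLinearMap.adjoint (fderiv ℝ (homExt φ) (greatTorus x).1) (‖P‖⁻¹ • P) =
      ‖P‖⁻¹ • (greatTorus x).2 := by rw [he, map_smul, hadj]
  have hP' : 0 < ‖P‖⁻¹ := inv_pos.2 (norm_pos_iff.2 hP)
  rw [heq]
  constructor
  · simp only [hψ, hA]
    rw [norm_smul, (greatTorus_mem x).2.2, mul_one, norm_inv, norm_norm, smul_smul,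
      inv_mul_cancel₀ hP'.ne', one_smul]
  · have hφ0 : φ (greatTorus x).1 ≠ 0 := ne_zero_of_mem_S3 (h.bijOn.mapsTo hq)
    have c1 : ContDiffAt ℝ ∞ (fun e : V4 × V4 => homExt ψ e.1) (φ (greatTorus x).1, ‖P‖⁻¹ • P) :=
      ContDiffAt.comp (f := Prod.fst) _ (contDiffAt_homExt h.inv_smooth hφ0) contDiffAt_fst
    have c2 : ContDiffAt ℝ ∞ (fun e : V4 × V4 => fderiv ℝ (homExt φ) (homExt ψ e.1))
        (φ (greatTorus x).1, ‖P‖⁻¹ • P) := by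
      refine ContDiffAt.comp (g := fderiv ℝ (homExt φ)) _ ?_ c1
      simp only [hψ]
      exact (contDiffAt_homExt h.smooth (greatTorus_fst_ne_zero x)).fderiv_right (by simp)
    have c3 := contDiffWithinAt_normalize (contDiffWithinAt_adjoint_apply
      (contDiffWithinAt_univ.2 c2) (contDiffWithinAt_univ.2 contDiffAt_snd)) (by
        simp only [hψ, hA]
        exact smul_ne_zero hP'.ne' (greatTorus_snd_ne_zero x))
    exact (c1.prodMk (contDiffWithinAt_univ.1 c3)).differentiableAt (by simp)

/-- The Legendrian condition survives since $\langle P,d\Phi\,dq\rangle=\langle p,dq\rangle$ and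
normalisation only rescales. The differentiable left inverse transfers immersivity and injectivity
from the model torus. -/
theorem isLegendrianEmbedding (h : IsSphereDiffeo φ ψ) (hs : ContDiff ℝ ∞ (conormalMap φ)) :
    IsLegendrianEmbedding (conormalMap φ) := by
  obtain ⟨H, hH⟩ := h.exists_leftInverse
  have hgt := isTorusMap_greatTorus.smooth.differentiable (by simp)
  refine ⟨⟨hs, fun x m n => ?_⟩, h.conormalMap_mem, fun x v => ?_, fun x => ?_, fun x y hxy => ?_⟩
  · simp only [conormalMap, isTorusMap_greatTorus.periodic]
  · obtain ⟨e, P, he, hP, -, -, hin, heq⟩ := h.conormalMap_eq x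
    have h1 : HasFDerivAt (fun y => homExt φ (greatTorus y).1) _ x :=
      (hasFDerivAt_homExt h.smooth (greatTorus_fst_ne_zero x)).comp x (hgt x).hasFDerivAt.fst
    have h2 : HasFDerivAt (fun y => (conormalMap φ y).1) _ x :=
      (hs.differentiable (by simp) x).hasFDerivAt.fst
    have h3 := congrArg (fun l : ℝ × ℝ →L[ℝ] V4 => l v) (h2.unique h1)
    have h4 : (fderiv ℝ (conormalMap φ) x v).1 = e (fderiv ℝ greatTorus x v).1 := by
      rw [he] at h3
      exact h3
    rw [alpha, h4, heq]
    simp only [real_inner_smul_left]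
    rw [hin]
    have := isLegendrianLift_greatTorus.legendrian x v
    rw [alpha] at this
    rw [this, mul_zero]
  · have h1 : (fderiv ℝ H (conormalMap φ x)).comp (fderiv ℝ (conormalMap φ) x) =
        fderiv ℝ greatTorus x := by
      rw [← fderiv_comp x (hH x).2 (hs.differentiable (by simp) x)]
      congr 1
      funext y
      exact (hH y).1
    have h2 : Function.Injective (fderiv ℝ greatTorus x) := by
      have h3 := injective_fderiv_proj_greatTorus x
      have h4 : fderiv ℝ (fun x => proj (greatTorus x)) x = _ :=
        fderiv_comp x (contDiff_proj.differentiable (by simp) _) (hgt x)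
      rw [h4] at h3
      exact Function.Injective.of_comp (f := fderiv ℝ proj (greatTorus x)) h3
    rw [← h1] at h2
    exact Function.Injective.of_comp (f := fderiv ℝ H (conormalMap φ x)) h2
  · refine greatTorus_eq_iff.1 ?_
    rw [← (hH x).1, ← (hH y).1, hxy]

theorem greatTorus_mem_greatCircle (x : ℝ × ℝ) : (greatTorus x).1 ∈ greatCircle :=
  ⟨greatTorus_fst_mem x, rfl, rfl⟩

/-- A curve in the image knot pulls back to the great circle, whose velocities pair to zero with
$p$. Conversely, the pulled-back covector kills the position vector by Euler's identity and the
tangent of the great circle by the conormal condition, hence the whole plane of the circle. -/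
theorem range_conormalMap (h : IsSphereDiffeo φ ψ) :
    range (conormalMap φ) = conormalLift (φ '' greatCircle) := by
  ext e
  constructor
  · rintro ⟨x, rfl⟩
    have hmem := h.conormalMap_mem x
    obtain ⟨l, P, hl, hP, -, -, hin, heq⟩ := h.conormalMap_eq x
    refine ⟨hmem, ?_, fun c hc hcK hc0 => ?_⟩
    · rw [heq]
      exact mem_image_of_mem _ (greatTorus_mem_greatCircle x)
    rw [heq] at hc0 ⊢
    have hψc : ∀ t, homExt ψ (c t) ∈ greatCircle ∧ homExt φ (homExt ψ (c t)) = c t := by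
      intro t
      obtain ⟨y, hy, hyt⟩ := hcK t
      rw [← hyt, homExt_of_mem ψ (h.bijOn.mapsTo hy.1), h.left_inv y hy.1, homExt_of_mem φ hy.1]
      exact ⟨hy, rfl⟩
    have hc0' : homExt ψ (c 0) = (greatTorus x).1 := by
      rw [hc0, homExt_of_mem ψ (h.bijOn.mapsTo (greatTorus_fst_mem x)),
        h.left_inv _ (greatTorus_fst_mem x)]
    have hc00 : c 0 ≠ 0 := by
      rw [hc0]
      exact ne_zero_of_mem_S3 (h.bijOn.mapsTo (greatTorus_fst_mem x))
    have d1 : HasDerivAt (fun t => homExt ψ (c t)) _ 0 :=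
      (hasFDerivAt_homExt h.inv_smooth hc00).comp_hasDerivAt 0
        (hc.differentiable (by simp) 0).hasDerivAt
    have d2 : HasDerivAt (fun t => homExt φ (homExt ψ (c t))) _ 0 :=
      (hasFDerivAt_homExt h.smooth (greatTorus_fst_ne_zero x)).comp_hasDerivAt_of_eq 0 d1 hc0'.symm
    have hcc : (fun t => homExt φ (homExt ψ (c t))) = c := funext fun t => (hψc t).2
    rw [hcc] at d2
    rw [d2.deriv, hl]
    simp only [real_inner_smul_left, ContinuousLinearEquiv.coe_coe]
    rw [hin, inner_V4]
    have z2 := (hasDerivAt_coord d1 2).unique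
      ((hasDerivAt_const (0 : ℝ) (0 : ℝ)).congr_of_eventuallyEq (.of_forall fun t => (hψc t).1.2.1))
    have z3 := (hasDerivAt_coord d1 3).unique
      ((hasDerivAt_const (0 : ℝ) (0 : ℝ)).congr_of_eventuallyEq (.of_forall fun t => (hψc t).1.2.2))
    rw [z2, z3]
    simp [greatTorus]
  · rintro ⟨hu, ⟨y, hy, hye⟩, hcurve⟩
    obtain ⟨a, ha⟩ : ∃ a, (greatTorus (a, 0)).1 = y := by
      have : (y, (!₂[0, 0, 1, 0] : V4)) ∈ range greatTorus := by
        rw [range_greatTorus]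
        refine ⟨⟨hy.1, ?_, by simp [EuclideanSpace.norm_eq, Fin.sum_univ_four]⟩, hy.2, rfl, rfl⟩
        rw [inner_V4]
        simp [hy.2.1]
      obtain ⟨⟨a, b⟩, hx⟩ := this
      exact ⟨a, congrArg Prod.fst hx⟩
    obtain ⟨l, hl⟩ := h.exists_fderiv_eq (ne_zero_of_mem_S3 hy.1)
    set p₀ := ContinuousLinearMap.adjoint (l : V4 →L[ℝ] V4) e.2 with hp₀
    have hin : ∀ v, ⟪p₀, v⟫ = ⟪e.2, l v⟫ := fun v => ContinuousLinearMap.adjoint_inner_left _ _ _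
    have hp0 : p₀ ≠ 0 := by
      intro h0
      have h1 := hin (l.symm e.2)
      rw [h0, inner_zero_left, ContinuousLinearEquiv.apply_symm_apply, (mem_UTS3.1 hu).2.2] at h1
      exact zero_ne_one h1
    have i1 : ⟪p₀, y⟫ = 0 := by
      have h1 := h.fderiv_self hy.1
      rw [hl, ContinuousLinearEquiv.coe_coe] at h1
      rw [hin, h1, hye, real_inner_comm]
      exact (mem_UTS3.1 hu).2.1
    -- The great circle parametrised through `y`; its image under `φ` is the test curve for the
    -- conormal condition.
    set c : ℝ → V4 := fun s => (greatTorus (a + s, 0)).1 with hcdef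
    have hcs : ContDiff ℝ ∞ c := contDiff_fst.comp
      (isTorusMap_greatTorus.smooth.comp ((contDiff_const.add contDiff_id).prodMk contDiff_const))
    have c0 : c 0 = y := by rw [hcdef]; simp only [add_zero, ha]
    have dc := (hcs.differentiable (by simp) 0).hasDerivAt
    have i2 : ⟪p₀, deriv c 0⟫ = 0 := by
      have d2 : HasDerivAt (fun s => homExt φ (c s)) (fderiv ℝ (homExt φ) y (deriv c 0)) 0 :=
        (hasFDerivAt_homExt h.smooth (ne_zero_of_mem_S3 hy.1)).comp_hasDerivAt_of_eq 0 dc c0.symm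
      have h1 := hcurve (fun s => homExt φ (c s))
        (contDiff_iff_contDiffAt.2 fun s => (contDiffAt_homExt h.smooth
          (greatTorus_fst_ne_zero _)).comp s hcs.contDiffAt)
        (fun s => by
          rw [hcdef, homExt_of_mem φ (greatTorus_fst_mem _)]
          exact mem_image_of_mem _ (greatTorus_mem_greatCircle _))
        (by rw [c0, homExt_of_mem φ hy.1, hye])
      rw [d2.deriv, hl] at h1
      rw [hin]
      exact h1
    have hlin : HasDerivAt (fun s : ℝ => 2 * Real.pi * (a + s)) (2 * Real.pi) 0 := by
      simpa using ((hasDerivAt_id (0 : ℝ)).const_add a).const_mul (2 * Real.pi)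
    have e0 := (hasDerivAt_coord dc 0).unique (((Real.hasDerivAt_cos _).comp 0 hlin).div_const 2)
    have e1 := (hasDerivAt_coord dc 1).unique (((Real.hasDerivAt_sin _).comp 0 hlin).div_const 2)
    have e2 := (hasDerivAt_coord dc 2).unique (hasDerivAt_const 0 0)
    have e3 := (hasDerivAt_coord dc 3).unique (hasDerivAt_const 0 0)
    rw [inner_V4, e0, e1, e2, e3] at i2
    rw [inner_V4, ← ha] at i1
    simp only [greatTorus, Matrix.cons_val, add_zero] at i1 i2
    have hcs1 := Real.cos_sq_add_sin_sq (2 * Real.pi * a)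
    have i2' : -p₀ 0 * Real.sin (2 * Real.pi * a) + p₀ 1 * Real.cos (2 * Real.pi * a) = 0 := by
      have : Real.pi * (-p₀ 0 * Real.sin (2 * Real.pi * a) + p₀ 1 * Real.cos (2 * Real.pi * a)) = 0 := by
        linarith
      exact (mul_eq_zero.1 this).resolve_left Real.pi_ne_zero
    have z0 : p₀ 0 = 0 := by
      linear_combination (-p₀ 0) * hcs1 + 2 * Real.cos (2 * Real.pi * a) * i1
        - Real.sin (2 * Real.pi * a) * i2'
    have z1 : p₀ 1 = 0 := by
      linear_combination (-p₀ 1) * hcs1 + 2 * Real.sin (2 * Real.pi * a) * i1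
        + Real.cos (2 * Real.pi * a) * i2'
    have hn : 0 < ‖p₀‖⁻¹ := inv_pos.2 (norm_pos_iff.2 hp0)
    obtain ⟨x, hx⟩ : (y, ‖p₀‖⁻¹ • p₀) ∈ range greatTorus := by
      rw [range_greatTorus]
      refine ⟨⟨hy.1, ?_, ?_⟩, hy.2, by simp [z0], by simp [z1]⟩
      · rw [inner_V4]
        simp [z0, z1, hy.2.1, hy.2.2]
      · simp only [norm_smul, norm_inv, norm_norm]
        exact inv_mul_cancel₀ (norm_ne_zero_iff.2 hp0)
    refine ⟨x, ?_⟩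
    have hP : ContinuousLinearMap.adjoint (l.symm : V4 →L[ℝ] V4) (‖p₀‖⁻¹ • p₀) = ‖p₀‖⁻¹ • e.2 := by
      rw [map_smul]
      congr 1
      refine ext_inner_right ℝ fun v => ?_
      rw [ContinuousLinearMap.adjoint_inner_left, hin]
      simp
    rw [conormalMap, hx, hl, ContinuousLinearMap.inverse_equiv, hP, homExt_of_mem φ hy.1, hye, norm_smul,
      hu.2.2, mul_one, norm_inv, norm_norm, smul_smul, inv_mul_cancel₀ hn.ne', one_smul]

end IsSphereDiffeo

/-! ### Smooth families and the Legendrian isotopy -/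

theorem IsAmbientIsotopy.exists_isSphereDiffeo {φ : ℝ → V4 → V4} (hφ : IsAmbientIsotopy φ) {t : ℝ}
    (ht : t ∈ Icc (0 : ℝ) 1) : ∃ ψ, IsSphereDiffeo (φ t) ψ := by
  obtain ⟨ψ, hψ, hinv⟩ := hφ.inverse_smooth t ht
  exact ⟨ψ, hφ.smooth.comp (contDiff_const.prodMk contDiff_id).contDiffOn fun x hx => ⟨ht, hx⟩, hψ,
    hφ.bijOn t ht, hinv⟩

theorem IsAmbientIsotopy.contDiffOn_conormalMap {φ : ℝ → V4 → V4} (hφ : IsAmbientIsotopy φ) :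
    ContDiffOn ℝ ∞ (fun p : ℝ × (ℝ × ℝ) => conormalMap (φ p.1) p.2) (Icc 0 1 ×ˢ univ) := by
  have hΦ := contDiffOn_homExt_joint hφ.smooth
  have hq : ContDiff ℝ ∞ fun p : ℝ × (ℝ × ℝ) => (p.1, (greatTorus p.2).1) :=
    contDiff_fst.prodMk (contDiff_fst.comp (isTorusMap_greatTorus.smooth.comp contDiff_snd))
  have hp : ContDiff ℝ ∞ fun p : ℝ × (ℝ × ℝ) => (greatTorus p.2).2 :=
    contDiff_snd.comp (isTorusMap_greatTorus.smooth.comp contDiff_snd)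
  have hmaps : MapsTo (fun p : ℝ × (ℝ × ℝ) => (p.1, (greatTorus p.2).1)) (Icc 0 1 ×ˢ univ)
      (Icc 0 1 ×ˢ {0}ᶜ) := fun p hp => ⟨hp.1, greatTorus_fst_ne_zero _⟩
  have hud : UniqueDiffOn ℝ (Icc (0 : ℝ) 1 ×ˢ ({0}ᶜ : Set V4)) :=
    (uniqueDiffOn_Icc zero_lt_one).prod isOpen_compl_singleton.uniqueDiffOn
  -- Joint smoothness of the spatial derivative: it is the joint derivative, taken within the closed
  -- time interval, restricted to vectors without time component.
  have hD : ContDiffOn ℝ ∞ (fun x : ℝ × V4 => fderiv ℝ (homExt (φ x.1)) x.2) (Icc 0 1 ×ˢ {0}ᶜ) := by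
    refine ((hΦ.fderivWithin hud (m := ∞) (by simp)).clm_comp
      (contDiffOn_const (c := ContinuousLinearMap.inr ℝ ℝ V4))).congr fun x hx => ?_
    have h1 := ((hΦ x hx).differentiableWithinAt (by simp)).hasFDerivWithinAt
    have h2 : HasFDerivWithinAt (fun y : V4 => (x.1, y)) (ContinuousLinearMap.inr ℝ ℝ V4) {0}ᶜ x.2 :=
      (hasFDerivAt_prodMk_right x.1 x.2).hasFDerivWithinAt
    have h3 : HasFDerivWithinAt (fun y : V4 => homExt (φ x.1) y) _ {0}ᶜ x.2 :=
      HasFDerivWithinAt.comp (g := fun x : ℝ × V4 => homExt (φ x.1) x.2) (f := fun y => (x.1, y)) x.2 h1 h2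
        fun y hy => ⟨hx.1, hy⟩
    exact (h3.hasFDerivAt (isOpen_compl_singleton.mem_nhds hx.2)).fderiv
  refine (hΦ.comp hq.contDiffOn hmaps).prodMk fun p hpm => ?_
  obtain ⟨ψ, hψ⟩ := hφ.exists_isSphereDiffeo hpm.1
  obtain ⟨e, P, he, hP, hPdef, -⟩ := hψ.conormalMap_eq p.2
  refine contDiffWithinAt_normalize (contDiffWithinAt_adjoint_apply ?_ hp.contDiffWithinAt) (hPdef ▸ hP)
  -- Inversion of operators is smooth at the invertible ones, and the derivative here is an
  -- isomorphism.
  refine ContDiffAt.comp_contDiffWithinAt (g := ContinuousLinearMap.inverse) p ?_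
    ((hD.comp hq.contDiffOn hmaps) p hpm)
  simp only [he]
  exact contDiffAt_map_inverse e

theorem conormalMap_of_eqOn {φ : V4 → V4} (h : ∀ x ∈ S3, φ x = x) : conormalMap φ = greatTorus := by
  funext x
  have hid : ∀ y : V4, y ≠ 0 → homExt φ y = y := fun y hy => by
    rw [homExt, h _ (radial_mem hy), smul_radial hy]
  have hD : fderiv ℝ (homExt φ) (greatTorus x).1 = (ContinuousLinearEquiv.refl ℝ V4 : V4 →L[ℝ] V4) := by
    refine HasFDerivAt.fderiv ((hasFDerivAt_id _).congr_of_eventuallyEq ?_)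
    filter_upwards [isOpen_compl_singleton.mem_nhds (greatTorus_fst_ne_zero x)] with y hy
    exact hid y hy
  have hA : ContinuousLinearMap.adjoint (((ContinuousLinearEquiv.refl ℝ V4).symm : V4 ≃L[ℝ] V4) :
      V4 →L[ℝ] V4) (greatTorus x).2 = (greatTorus x).2 := by
    refine ext_inner_right ℝ fun v => ?_
    rw [ContinuousLinearMap.adjoint_inner_left]
    rfl
  rw [conormalMap, hD, ContinuousLinearMap.inverse_equiv, hA, hid _ (greatTorus_fst_ne_zero x),
    (greatTorus_mem x).2.2, inv_one, one_smul]

/-- The Reeb flow takes the conormal torus of the great circle to a torus that is Legendrian isotopic to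
the conormal lift of any unknot. -/
theorem legendrianIsotopic_conormalLift (t₀ : ℝ) {K : Set V4} (hK : IsUnknot K) :
    LegendrianIsotopic (reebFlow t₀ '' range greatTorus) (conormalLift K) := by
  obtain ⟨φ, hφ, rfl⟩ := hK
  have hs := hφ.contDiffOn_conormalMap
  -- The Reeb time falls from `t₀` to $0$ while the ambient isotopy runs, so a single smooth family
  -- joins both ends without concatenation.
  refine ⟨fun t x => reebFlow (t₀ * (1 - t)) (conormalMap (φ t) x), ?_, fun t ht => ?_, ?_, ?_⟩
  · have h1 := contDiff_fst.comp_contDiffOn hs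
    have h2 := contDiff_snd.comp_contDiffOn hs
    have hc : ContDiff ℝ ∞ fun p : ℝ × (ℝ × ℝ) => Real.cos (2 * (t₀ * (1 - p.1))) := by fun_prop
    have hsin : ContDiff ℝ ∞ fun p : ℝ × (ℝ × ℝ) => Real.sin (2 * (t₀ * (1 - p.1))) := by fun_prop
    exact ((hc.contDiffOn.smul h1).add ((hsin.div_const 2).contDiffOn.smul h2)).prodMk
      (((contDiff_const.mul hsin).neg.contDiffOn.smul h1).add (hc.contDiffOn.smul h2))
  · obtain ⟨ψ, hψ⟩ := hφ.exists_isSphereDiffeo ht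
    refine (hψ.isLegendrianEmbedding ?_).reebFlow _
    rw [← contDiffOn_univ]
    exact hs.comp (contDiff_const.prodMk contDiff_id).contDiffOn fun x _ => ⟨ht, trivial⟩
  · simp only [conormalMap_of_eqOn hφ.start, sub_zero, mul_one]
    rw [← range_comp]
    rfl
  · obtain ⟨ψ, hψ⟩ := hφ.exists_isSphereDiffeo (right_mem_Icc.2 zero_le_one)
    simp only [sub_self, mul_zero, reebFlow_zero]
    exact hψ.range_conormalMap

end UnknotLift

theorem mainTheorem8 :
    UnknotLift.IsPrequantisation UnknotLift.proj ∧
    (∃ ι f, UnknotLift.IsCanonicalCover UnknotLift.productTorus 2 ι ∧ UnknotLift.IsLegendrianLift ι f) ∧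
    ∀ ι f, UnknotLift.IsCanonicalCover UnknotLift.productTorus 2 ι → UnknotLift.IsLegendrianLift ι f →
      UnknotLift.IsLegendrianEmbedding f ∧
      ∀ K, UnknotLift.IsUnknot K →
        UnknotLift.LegendrianIsotopic (Set.range f) (UnknotLift.conormalLift K) := by
  refine ⟨UnknotLift.isPrequantisation_proj, ⟨_, _, UnknotLift.isCanonicalCover_greatTorus,
    UnknotLift.isLegendrianLift_greatTorus⟩, fun ι f hι hf => ?_⟩
  obtain ⟨hemb, t, ht⟩ := hf.embedding hι
  exact ⟨hemb, fun K hK => ht ▸ UnknotLift.legendrianIsotopic_conormalLift t hK⟩
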